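/- Let $(V,Y,\mathbf 1,\omega)$ be a vertex operator algebra over $\mathbb C$ of CFT-type, i.e. $V=\bigoplus_{n\in\mathbb Z}V_n$ with $\dim V_n<\infty$, $V_0=\mathbb C\mathbf 1$, $\mathbf 1\neq 0$, and write $Y(\omega,z)=\sum_{n\in\mathbb Z}L_nz^{-n-2}$. Let $\mathbf 1'$ be the linear functional on $V$ with $\langle\mathbf 1',\mathbf 1\rangle=1$ that vanishes on $V_n$ for $n\ne0$, and for $v_1,\dots,v_n\in V$ define the genus zero $n$-point correlation function as the formal series $$Z(v_1,z_1;\dots;v_n,z_n)=\langle\mathbf 1',Y(v_1,z_1)\cdots Y(v_n,z_n)\mathbf 1\rangle .$$ 1. For every $m\ge 0$ there is a unique rational function $G_m(z_1,\dots,z_m)\in\mathbb C(z_1,\dots,z_m)$ whose expansion in the domain $|z_1|>\dots>|z_m|$ is $Z(\omega,z_1;\dots;\omega,z_m)$, and $G_m$ is symmetric in $z_1,\dots,z_m$. 2. The functions $G_m$ generate all genus zero correlation functions of Virasoro vacuum descendants, in the following sense. Let $n\ge 0$, let $r_1,\dots,r_n\ge 0$ be integers, let $l_{ij}\in\mathbb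 Z$ for $1\le i\le n$, $1\le j\le r_i$, and put $v_i=L_{-l_{i1}}L_{-l_{i2}}\cdots L_{-l_{ir_i}}\mathbf 1$ and $N=r_1+\dots+r_n$. Then $Z(v_1,w_1;\dots;v_n,w_n)$ is the coefficient of $\prod_{i=1}^n\prod_{j=1}^{r_i}x_{ij}^{\,l_{ij}-2}$ in the expansion of $$G_N(x_{11}+w_1,\dots,x_{1r_1}+w_1,\;\dots,\;x_{n1}+w_n,\dots,x_{nr_n}+w_n)$$ in the domain $|w_1|>\dots>|w_n|>|x_{11}|>\dots>|x_{1r_1}|>\dots>|x_{n1}|>\dots>|x_{nr_n}|$, where each variable is treated as infinitely small compared with the preceding ones. -/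

import Mathlib

open scoped VertexOperator

noncomputable section

/-! ### Vertex operator algebras -/

/-- A vertex operator algebra `(V, Y, 𝟏, ω)` over `ℂ` with grading `V = ⨁ₙ Vₙ` (`grade n = Vₙ`) and
central charge `charge`. The mode `vₙ`, defined by `Y(v, z) = ∑ₙ vₙ z^(-n-1)`, is `(Y v)[[n]]`.
Lower truncation (`vₙ u = 0` for `n ≫ 0`) is part of Mathlib's notion of a vertex operator, which
sends each vector to a formal Laurent series with finitely many negative powers of `z`. -/
structure VOA (V : Type*) [AddCommGroup V] [Module ℂ V] where
  grade : ℤ → Submodule ℂ V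
  isInternal : DirectSum.IsInternal grade
  finiteDimensional : ∀ n, FiniteDimensional ℂ (grade n)
  Y : V →ₗ[ℂ] VertexOperator ℂ V
  vac : V
  vac_mem : vac ∈ grade 0
  omega : V
  omega_mem : omega ∈ grade 2
  charge : ℂ
  /-- `(z₁ - z₂)^N [Y(u, z₁), Y(v, z₂)] = 0` for some `N`, i.e. the coefficient of
  `z₁^(-m-1) z₂^(-n-1)` vanishes for all `m`, `n`. -/
  locality : ∀ u v : V, ∃ N : ℕ, ∀ m n : ℤ,
    ∑ i ∈ Finset.range (N + 1), ((-1 : ℂ) ^ i * (N.choose i : ℂ)) •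
      ((Y u)[[m + N - i]] * (Y v)[[n + i]] - (Y v)[[n + i]] * (Y u)[[m + N - i]]) = 0
  /-- `Y(v, z)𝟏 = v + O(z)`. -/
  creativity : ∀ v : V, (∀ n : ℤ, 0 ≤ n → ((Y v)[[n]]) vac = 0) ∧ ((Y v)[[-1]]) vac = v
  /-- `Lₙ = ωₙ₊₁` satisfy the Virasoro relations with central charge `charge`. -/
  virasoro : ∀ m n : ℤ,
    (Y omega)[[m + 1]] * (Y omega)[[n + 1]] - (Y omega)[[n + 1]] * (Y omega)[[m + 1]] =
      ((m : ℂ) - n) • (Y omega)[[m + n + 1]] +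
        (if m = -n then ((m : ℂ) ^ 3 - m) / 12 * charge else 0) • (1 : Module.End ℂ V)
  /-- `L₀ v = n v` for `v ∈ Vₙ`. -/
  L_zero : ∀ n : ℤ, ∀ v ∈ grade n, ((Y omega)[[(0 : ℤ) + 1]]) v = (n : ℂ) • v
  /-- `[L₋₁, Y(v, z)] = ∂_z Y(v, z)`. -/
  translation : ∀ (v : V) (n : ℤ),
    (Y omega)[[(-1 : ℤ) + 1]] * (Y v)[[n]] - (Y v)[[n]] * (Y omega)[[(-1 : ℤ) + 1]] =
      (-(n : ℂ)) • (Y v)[[n - 1]]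

namespace VOA

variable {V : Type*} [AddCommGroup V] [Module ℂ V] (A : VOA V)

/-- CFT-type: `V₀ = ℂ𝟏` is one-dimensional. -/
structure IsCFTType : Prop where
  vac_ne_zero : A.vac ≠ 0
  grade_zero : A.grade 0 = Submodule.span ℂ {A.vac}

/-- The Virasoro mode `Lₙ = ωₙ₊₁`. -/
def L (n : ℤ) : Module.End ℂ V := (A.Y A.omega)[[n + 1]]

theorem bijective_coeLinearMap : Function.Bijective (DirectSum.coeLinearMap A.grade) := A.isInternal

/-- The homogeneous component of a vector in `Vₙ`. -/
def component (n : ℤ) : V →ₗ[ℂ] A.grade n :=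
  DirectSum.component ℂ ℤ (fun i => A.grade i) n ∘ₗ
    (LinearEquiv.ofBijective (DirectSum.coeLinearMap A.grade) A.bijective_coeLinearMap).symm.toLinearMap

/-- The dual vacuum `𝟏'`: the component of a vector in `V₀ = ℂ𝟏`, as a multiple of `𝟏`. -/
def vacDual {A : VOA V} (h : A.IsCFTType) : V →ₗ[ℂ] ℂ :=
  (LinearEquiv.coord ℂ V A.vac h.vac_ne_zero).toLinearMap ∘ₗ
    (LinearEquiv.ofEq _ _ h.grade_zero).toLinearMap ∘ₗ A.component 0

/-- The genus zero `n`-point function `⟨𝟏', Y(v₁, z₁) ⋯ Y(vₙ, zₙ)𝟏⟩` as a formal series, given by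
its coefficients: `npt h v k` is the coefficient of `z₁^(k₁) ⋯ zₙ^(kₙ)`. -/
def npt {A : VOA V} (h : A.IsCFTType) {n : ℕ} (v : Fin n → V) (k : Fin n → ℤ) : ℂ :=
  vacDual h ((List.ofFn fun i => HVertexOperator.coeff (A.Y (v i)) (k i)).prod A.vac)

/-- The Virasoro vacuum descendant `L_{-l₁} ⋯ L_{-lᵣ}𝟏`. -/
def descendant {r : ℕ} (l : Fin r → ℤ) : V :=
  (List.ofFn fun i => A.L (-(l i))).prod A.vac

end VOA

/-! ### Rational functions and their expansions -/

/-- The field `ℂ(z₁, …, zₙ)`. -/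
abbrev MvRat (n : ℕ) : Type := FractionRing (MvPolynomial (Fin n) ℂ)

namespace MvRat

/-- The value `f(u₁, …, uₙ)` of a rational function `f` at elements `u₁, …, uₙ` of a field
containing `ℂ`. -/
def eval {n : ℕ} {F : Type*} [Field F] [Algebra ℂ F] (f : MvRat n) (u : Fin n → F) : F :=
  MvPolynomial.aeval u (IsFractionRing.num (MvPolynomial (Fin n) ℂ) f) /
    MvPolynomial.aeval u (IsFractionRing.den (MvPolynomial (Fin n) ℂ) f : MvPolynomial (Fin n) ℂ)

/-- The variable `zᵢ`. -/
def var {n : ℕ} (i : Fin n) : MvRat n := algebraMap (MvPolynomial (Fin n) ℂ) _ (MvPolynomial.X i)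

/-- `f` is symmetric: `f(z_{σ(1)}, …, z_{σ(n)}) = f(z₁, …, zₙ)` for all permutations `σ`. -/
def IsSymmetric {n : ℕ} (f : MvRat n) : Prop :=
  ∀ σ : Equiv.Perm (Fin n), f.eval (fun i => var (σ i)) = f

end MvRat

/-- The exponents `(k₁, …, kₙ)` of Laurent monomials, ordered by comparing the last entry first,
then the one before it, and so on. -/
def Exponent (n : ℕ) : Type := Colex (Fin n → ℤ)

namespace Exponent

instance (n : ℕ) : AddCommGroup (Exponent n) := inferInstanceAs (AddCommGroup (Colex (Fin n → ℤ)))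

instance (n : ℕ) : LinearOrder (Exponent n) := inferInstanceAs (LinearOrder (Colex (Fin n → ℤ)))

/-- A tuple of integers as an exponent. -/
def of {n : ℕ} (k : Fin n → ℤ) : Exponent n := toColex k

theorem lt_iff {n : ℕ} (k k' : Fin n → ℤ) :
    of k < of k' ↔ ∃ i, (∀ j, i < j → k j = k' j) ∧ k i < k' i := Iff.rfl

instance (n : ℕ) : IsOrderedAddMonoid (Exponent n) where
  add_le_add_left a b hab c := by
    rcases hab.eq_or_lt with rfl | ⟨i, hi, h⟩
    · exact le_rfl
    · refine le_of_lt ⟨i, fun j hj => congrArg (· + (ofColex c) j) (hi j hj), ?_⟩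
      exact add_lt_add_left (α := ℤ) h ((ofColex c) i)

end Exponent

/-- The field of formal series `∑_k c_k z₁^(k₁) ⋯ zₙ^(kₙ)` whose support is well-ordered for the
order of `Exponent n`. Here `zᵢ₊₁` is infinitely small compared with every power of `zᵢ`, so that
the inclusion of `ℂ(z₁, …, zₙ)` in this field is the expansion in the domain
`|z₁| > ⋯ > |zₙ|`. -/
abbrev ExpansionField (n : ℕ) : Type := HahnSeries (Exponent n) ℂ

namespace ExpansionField

/-- The variable `zᵢ`. -/
def var {n : ℕ} (i : Fin n) : ExpansionField n :=
  HahnSeries.single (Exponent.of (Pi.single i (1 : ℤ))) (1 : ℂ)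

/-- The coefficient of `z₁^(k₁) ⋯ zₙ^(kₙ)`. -/
def coefficient {n : ℕ} (s : ExpansionField n) (k : Fin n → ℤ) : ℂ := s.coeff (Exponent.of k)

end ExpansionField

/-- The expansion of `f(z₁, …, zₙ)` in the domain `|z₁| > ⋯ > |zₙ|`. -/
def MvRat.expand {n : ℕ} (f : MvRat n) : ExpansionField n := f.eval ExpansionField.var

/-- For `r₁, …, rₙ` and `N = r₁ + ⋯ + rₙ`, consider variables `w₁, …, wₙ` followed by `N` variables
`x₁₁, …, x₁ᵣ₁, …, xₙ₁, …, xₙᵣₙ`. For a rational function `f` of `N` arguments,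
`f.shiftedExpand r` is the expansion of
`f(x₁₁ + w₁, …, x₁ᵣ₁ + w₁, …, xₙ₁ + wₙ, …, xₙᵣₙ + wₙ)` in the domain
`|w₁| > ⋯ > |wₙ| > |x₁₁| > ⋯ > |x₁ᵣ₁| > ⋯ > |xₙ₁| > ⋯ > |xₙᵣₙ|`, each variable being infinitely
small compared with the preceding ones. -/
def MvRat.shiftedExpand {n : ℕ} (r : Fin n → ℕ) (f : MvRat (∑ i, r i)) :
    ExpansionField (n + ∑ i, r i) :=
  f.eval fun a => ExpansionField.var (Fin.natAdd n a) +
    ExpansionField.var (Fin.castAdd (∑ i, r i) (finSigmaFinEquiv.symm a).1)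

end

/-! Part 1. Fields of a vertex algebra are mutually local, so the series ⟨𝟏', Y(ω, z₁) ⋯ Y(ω, z_m)𝟏⟩
no longer depends on the order of its factors once it is multiplied by `disc`, the product of (z_a -
z_b)^N over ordered pairs a ≠ b. Moving the a-th field to the right end shows that no negative
powers of z_a occur, by creativity. Moving it to the left end bounds the powers from above, because
𝟏' kills L_n u for n ≤ 1 and u in the Virasoro module of the vacuum. Hence the cleared series is a
polynomial Q (`exists_act_disc`), and G_m = Q / `disc`. Both Q and `disc` are symmetric, and G_m is
unique because expansion is injective on rational functions.

Part 2. Since L_{-l} is the coefficient of x^(l-2) in Y(ω, x), a descendant is a coefficient of Y(ω,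
x₁) ⋯ Y(ω, x_r)𝟏, and the field of this product at w is a "cluster" of fields of ω centred at w. The
iterate formula `mode_mode` writes Y(Y(a, x)b, w) as a residue of the two orderings of Y(a, z) and
Y(b, w). Such residues turn multiplication by p(z, w) into multiplication by p(x + w, w), and they
fix constants. So if both orderings become the same polynomial q after multiplication by p, the
iterate becomes q(x + w, w) after multiplication by p(x + w, w). Pulling the fields of ω out of the
clusters one at a time reduces to Part 1, with Y(𝟏, w) = 1 removing the empty clusters
(`act_insertionProd`). Both series lie in the Hahn series field of the expansion, where the
denominator can be divided out.

The iterate formula rests on Goddard's uniqueness theorem: both sides are local with all fields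
(Dong's lemma, `resProd_isVacLocal`), and on the vacuum they solve the same equation L₋₁F = ∂F with
the same constant term. -/

/-! ### Formal distributions -/

/-- The action of polynomials on formal distributions `∑ₑ f(e) z^e`, by multiplication. -/
noncomputable def FormalDist.act {κ E : Type*} [AddCommGroup E] [Module ℂ E] :
    MvPolynomial κ ℂ →ₐ[ℂ] Module.End ℂ ((κ → ℤ) → E) :=
  AddMonoidAlgebra.lift ℂ (Module.End ℂ ((κ → ℤ) → E)) (κ →₀ ℕ)
    { toFun := fun s =>
        { toFun := fun f e => f (fun i => e i - (s.toAdd i : ℤ))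
          map_add' := fun _ _ => rfl
          map_smul' := fun _ _ => rfl }
      map_one' := by ext f e; simp
      map_mul' := fun s t => by
        ext f e
        simp only [toAdd_mul, Finsupp.coe_add, Pi.add_apply, Nat.cast_add, LinearMap.coe_mk,
          AddHom.coe_mk, Module.End.mul_apply]
        congr 1; funext i; ring }

namespace FormalDist

variable {κ : Type*} {E : Type*} [AddCommGroup E] [Module ℂ E]

theorem act_monomial (s : κ →₀ ℕ) (c : ℂ) (f : (κ → ℤ) → E) (e : κ → ℤ) :
    act (MvPolynomial.monomial s c) f e = c • f (fun i => e i - (s i : ℤ)) := by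
  have : act (E := E) (MvPolynomial.monomial s c) = c • _ := AddMonoidAlgebra.lift_single _ s c
  rw [this]; rfl

theorem act_C (c : ℂ) (f : (κ → ℤ) → E) : act (MvPolynomial.C c) f = c • f := by
  funext e
  rw [MvPolynomial.C_apply, act_monomial]; simp

theorem act_mul (p q : MvPolynomial κ ℂ) (f : (κ → ℤ) → E) :
    act (p * q) f = act p (act q f) := by
  rw [map_mul]; rfl

theorem act_add (p q : MvPolynomial κ ℂ) (f : (κ → ℤ) → E) :
    act (p + q) f = act p f + act q f := by
  rw [map_add]; rfl

theorem act_comm (p q : MvPolynomial κ ℂ) (f : (κ → ℤ) → E) :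
    act p (act q f) = act q (act p f) := by
  rw [← act_mul, mul_comm, act_mul]

/-- A coefficient of a product vanishes if all the coefficients contributing to it vanish. -/
theorem act_eq_zero_of_shift (p : MvPolynomial κ ℂ) {f : (κ → ℤ) → E} {e : κ → ℤ}
    (h : ∀ s ∈ p.support, f (fun i => e i - (s i : ℤ)) = 0) : act p f e = 0 := by
  rw [p.as_sum, map_sum]
  simp only [LinearMap.coe_sum, Finset.sum_apply, act_monomial]
  exact Finset.sum_eq_zero fun s hs => by rw [h s hs, smul_zero]

/-- The action preserves distributions vanishing on a set of exponents that is stable under the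
shifts. -/
theorem act_eq_zero_of_stable (p : MvPolynomial κ ℂ) {f : (κ → ℤ) → E} {S : Set (κ → ℤ)}
    (hS : ∀ e ∈ S, ∀ s : κ →₀ ℕ, (fun i => e i - (s i : ℤ)) ∈ S) (h : ∀ e ∈ S, f e = 0) :
    ∀ e ∈ S, act p f e = 0 :=
  fun e he => act_eq_zero_of_shift p fun s _ => h _ (hS e he s)

theorem act_X [DecidableEq κ] (i : κ) (f : (κ → ℤ) → E) (e : κ → ℤ) :
    act (MvPolynomial.X i) f e = f (e - Pi.single i 1) := by
  rw [MvPolynomial.X, act_monomial, one_smul]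
  congr 1; funext j
  rcases eq_or_ne j i with rfl | h
  · simp
  · simp [Finsupp.single_eq_of_ne h, h]

/-- The constant distribution `v`. -/
noncomputable def const (v : E) : (κ → ℤ) → E := open Classical in fun e => if e = 0 then v else 0

theorem act_const_natCast (p : MvPolynomial κ ℂ) (s : κ →₀ ℕ) :
    act p (const (1 : ℂ)) (fun i => (s i : ℤ)) = p.coeff s := by
  classical
  induction p using MvPolynomial.induction_on' with
  | monomial t c =>
    rw [act_monomial, MvPolynomial.coeff_monomial, const]
    by_cases h : t = s
    · subst h
      simp [funext_iff]
    · rw [if_neg h, if_neg, smul_zero]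
      intro h'
      apply h
      ext i
      have := congrFun h' i
      simp only [Pi.zero_apply] at this
      omega
  | add p q hp hq => simp [hp, hq]

/-- The coefficients of p · 1 are those of p, so a polynomial is recovered from its action on the
constant 1. -/
theorem act_const_injective :
    Function.Injective fun p : MvPolynomial κ ℂ => act p (const (1 : ℂ)) := by
  intro p q h
  ext s
  rw [← act_const_natCast, ← act_const_natCast]
  exact congrFun h _

/-- A formal distribution with finite support in the nonnegative exponents is a polynomial. -/
theorem exists_act_const_eq [Finite κ] (f : (κ → ℤ) → ℂ) (B : ℤ) (h₀ : ∀ e i, e i < 0 → f e = 0)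
    (hB : ∀ e i, B < e i → f e = 0) :
    ∃ q : MvPolynomial κ ℂ, f = act q (const (1 : ℂ)) := by
  classical
  cases nonempty_fintype κ
  have hfin : (Function.support fun s : κ →₀ ℕ => f fun i => (s i : ℤ)).Finite := by
    have hinj : Function.Injective fun s : κ →₀ ℕ => (fun i => s i : κ → ℕ) :=
      DFunLike.coe_injective
    refine Set.Finite.subset (Set.Finite.preimage (hinj.injOn)
      (Set.finite_Iic (fun _ : κ => B.toNat))) fun s hs i => ?_
    by_contra hlt
    refine hs (hB _ i ?_)
    simp only at hlt ⊢
    omega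
  refine ⟨AddMonoidAlgebra.ofCoeff (Finsupp.ofSupportFinite _ hfin), ?_⟩
  funext e
  by_cases he : ∃ i, e i < 0
  · obtain ⟨i, hi⟩ := he
    rw [h₀ e i hi, act_eq_zero_of_stable (S := {e | e i < 0}) _ _ _ e hi]
    · intro e he s
      simp only [Set.mem_ofPred_eq] at he ⊢
      omega
    · intro e he
      rw [const, if_neg]
      rintro rfl
      simp at he
  · push Not at he
    have hc : e = fun i => ((Finsupp.equivFunOnFinite.symm fun i => (e i).toNat : κ →₀ ℕ) i : ℤ) := by
      funext i
      simp [he i]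
    rw [hc, act_const_natCast]
    rfl

theorem act_sub_pow [DecidableEq κ] (a b : κ) (n : ℕ) (f : (κ → ℤ) → E) (e : κ → ℤ) :
    act ((MvPolynomial.X a - MvPolynomial.X b) ^ n) f e =
      ∑ j ∈ Finset.range (n + 1), ((-1 : ℂ) ^ j * (n.choose j : ℂ)) •
        f (e - Pi.single a ((n : ℤ) - j) - Pi.single b (j : ℤ)) := by
  have hX : ∀ (i : κ) (j : ℕ) (f : (κ → ℤ) → E) (e : κ → ℤ),
      act (MvPolynomial.X i ^ j) f e = f (e - Pi.single i (j : ℤ)) := by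
    intro i j
    induction j with
    | zero => intro f e; simp
    | succ j ih =>
      intro f e
      rw [pow_succ, act_mul, ih, act_X, sub_sub, ← Pi.single_add]
      push_cast; rfl
  rw [sub_eq_neg_add, add_pow, map_sum]
  simp only [LinearMap.coe_sum, Finset.sum_apply]
  refine Finset.sum_congr rfl fun j hj => ?_
  have hj' : j ≤ n := Nat.lt_succ_iff.mp (Finset.mem_range.mp hj)
  have : ((-MvPolynomial.X b : MvPolynomial κ ℂ) ^ j * MvPolynomial.X a ^ (n - j) * (n.choose j : MvPolynomial κ ℂ))
      = MvPolynomial.C ((-1 : ℂ) ^ j * (n.choose j : ℂ)) * (MvPolynomial.X b ^ j * MvPolynomial.X a ^ (n - j)) := by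
    rw [neg_pow]; simp only [map_mul, map_pow, map_neg, map_one, map_natCast]; ring
  rw [this, act_mul, act_C, Pi.smul_apply, act_mul, hX, hX, sub_right_comm, Nat.cast_sub hj']

end FormalDist

/-! ### Residues and the substitution z ↦ x + w -/

namespace FormalDist

variable {κ : Type*} [DecidableEq κ] {E : Type*} [AddCommGroup E]

/-- `h(x, w) = ∑ₘ x^m Res_z ((z - w)^(-m-1) f(z, w) - (-w + z)^(-m-1) g(z, w))`, where the two
powers are expanded in the domains `|z| > |w|` and `|w| > |z|`. The variable `x` of `h` is
indexed by `z`. -/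
def IsResidue (z w : κ) (f g h : (κ → ℤ) → E) : Prop :=
  ∀ e : κ → ℤ, ∃ K₀ : ℕ, ∀ K ≥ K₀, ∀ K' ≥ K₀, h e =
    ∑ j ∈ Finset.range K, Ring.multichoose (e z + 1) j •
        f (e + (j : ℤ) • (Pi.single z 1 - Pi.single w 1)) +
      ∑ j ∈ Finset.range K', ((e z).negOnePow : ℤ) • Ring.multichoose (e z + 1) j •
        g (e - (e z + 1 + j) • (Pi.single z 1 - Pi.single w 1))

/-- The substitution `z ↦ x + w`. -/
noncomputable def translateVar (z w : κ) : MvPolynomial κ ℂ →ₐ[ℂ] MvPolynomial κ ℂ :=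
  MvPolynomial.bind₁ (Function.update MvPolynomial.X z (MvPolynomial.X z + MvPolynomial.X w))

variable {z w : κ} {f g h f' g' h' : (κ → ℤ) → E}

theorem IsResidue.unique (hh : IsResidue z w f g h) (hh' : IsResidue z w f g h') : h = h' := by
  funext e
  obtain ⟨K, hK⟩ := hh e
  obtain ⟨K', hK'⟩ := hh' e
  rw [hK (max K K') (le_max_left _ _) (max K K') (le_max_left _ _),
    hK' (max K K') (le_max_right _ _) (max K K') (le_max_right _ _)]

theorem IsResidue.add (hh : IsResidue z w f g h) (hh' : IsResidue z w f' g' h') :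
    IsResidue z w (f + f') (g + g') (h + h') := by
  intro e
  obtain ⟨K, hK⟩ := hh e
  obtain ⟨K', hK'⟩ := hh' e
  refine ⟨max K K', fun L hL L' hL' => ?_⟩
  rw [Pi.add_apply, hK L (le_trans (le_max_left _ _) hL) L' (le_trans (le_max_left _ _) hL'),
    hK' L (le_trans (le_max_right _ _) hL) L' (le_trans (le_max_right _ _) hL')]
  simp only [Pi.add_apply, smul_add, Finset.sum_add_distrib]
  abel

/-- In the second sum z has exponent -1 - j ≠ 0, so every term vanishes. In the first, a term with j
> 0 can be nonzero only if e z = -j, and then its multichoose coefficient is 0. What is left is j =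
0. -/
theorem isResidue_const (hzw : z ≠ w) (v : E) :
    IsResidue z w (const v) (const v) (const v) := by
  intro e
  refine ⟨1, fun K hK K' hK' => ?_⟩
  have hd : ∀ j : ℤ, (j • (Pi.single z 1 - Pi.single w 1 : κ → ℤ)) z = j := by
    intro j; simp [hzw]
  rw [Finset.sum_eq_single_of_mem 0 (Finset.mem_range.2 hK), Finset.sum_eq_zero]
  · simp
  · intro j _
    rw [const, if_neg, smul_zero, smul_zero]
    intro h
    have := congrFun h z
    rw [Pi.sub_apply, hd, Pi.zero_apply] at this
    omega
  · intro j _ hj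
    obtain ⟨j, rfl⟩ := Nat.exists_eq_succ_of_ne_zero hj
    rw [const]
    split_ifs with h
    · have := congrFun h z
      rw [Pi.add_apply, hd, Pi.zero_apply] at this
      have : e z + 1 = -(j : ℤ) := by push_cast at this; omega
      rw [this, Nat.succ_eq_add_one, Ring.multichoose_neg_succ, zero_smul]
    · rw [smul_zero]

variable [Module ℂ E]

theorem IsResidue.map {E' : Type*} [AddCommGroup E'] [Module ℂ E'] (φ : E →ₗ[ℂ] E')
    (hh : IsResidue z w f g h) :
    IsResidue z w (fun e => φ (f e)) (fun e => φ (g e)) (fun e => φ (h e)) := by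
  intro e
  obtain ⟨K, hK⟩ := hh e
  refine ⟨K, fun L hL L' hL' => ?_⟩
  simp only [hK L hL L' hL', map_add, map_sum, map_zsmul]

theorem IsResidue.smul (c : ℂ) (hh : IsResidue z w f g h) :
    IsResidue z w (c • f) (c • g) (c • h) :=
  hh.map (c • LinearMap.id)

theorem IsResidue.act_X_of_ne (hh : IsResidue z w f g h) {i : κ} (hi : i ≠ z) :
    IsResidue z w (act (MvPolynomial.X i) f) (act (MvPolynomial.X i) g)
      (act (MvPolynomial.X i) h) := by
  intro e
  obtain ⟨K, hK⟩ := hh (e - Pi.single i 1)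
  refine ⟨K, fun L hL L' hL' => ?_⟩
  have hz : (e - Pi.single i 1 : κ → ℤ) z = e z := by simp [hi.symm]
  rw [act_X, hK L hL L' hL', hz]
  simp only [act_X, sub_add_eq_add_sub, sub_right_comm]

/-- The identity z = (z - w) + w, which on the coefficients of the powers of z - w is Pascal's rule
for multichoose. -/
theorem IsResidue.act_X_self (hzw : z ≠ w) (hh : IsResidue z w f g h) :
    IsResidue z w (act (MvPolynomial.X z) f) (act (MvPolynomial.X z) g)
      (act (MvPolynomial.X z + MvPolynomial.X w) h) := by
  intro e
  obtain ⟨K₁, hK₁⟩ := hh (e - Pi.single z 1)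
  obtain ⟨K₂, hK₂⟩ := hh (e - Pi.single w 1)
  refine ⟨max K₁ K₂ + 1, fun L hL L' hL' => ?_⟩
  obtain ⟨L, rfl⟩ : ∃ n, L = n + 1 := ⟨L - 1, by omega⟩
  have h₁ : (e - Pi.single z 1 : κ → ℤ) z = e z - 1 := by simp
  have h₂ : (e - Pi.single w 1 : κ → ℤ) z = e z := by simp [hzw]
  -- The lengths are chosen so that Pascal's rule matches the truncated sums term by term. For this
  -- the truncations of the f-sum and the g-sum have to be independent.
  rw [act_add, Pi.add_apply, act_X, act_X, hK₁ (L + 1) (by omega) (L' + 1) (by omega),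
    hK₂ L (by omega) (L' + 1) (by omega), h₁, h₂]
  simp only [act_X, sub_add_cancel]
  set d : κ → ℤ := Pi.single z 1 - Pi.single w 1 with hd
  set m := e z
  have hw : e - Pi.single w 1 = e - Pi.single z 1 + d := by rw [hd]; abel
  have hF : ∀ j : ℤ, e + j • d - Pi.single z 1 = e - Pi.single z 1 + j • d := fun j => by abel
  have hF' : ∀ j : ℤ, e - Pi.single w 1 + j • d = e - Pi.single z 1 + (j + 1) • d := fun j => by
    rw [hw, add_smul, one_smul]; abel
  have hG : ∀ j : ℤ, e - (m + 1 + j) • d - Pi.single z 1 = e - Pi.single z 1 - (m + (j + 1)) • d :=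
    fun j => by rw [sub_right_comm, add_assoc, add_comm 1 j]
  have hG' : ∀ j : ℤ, e - Pi.single w 1 - (m + 1 + j) • d = e - Pi.single z 1 - (m + j) • d :=
    fun j => by rw [hw, add_right_comm m, add_smul (m + j), one_smul]; abel
  have hs : ((m - 1).negOnePow : ℤ) = -(m.negOnePow : ℤ) := by
    rw [Int.negOnePow_sub]; simp
  simp only [hF, hF', hG, hG', hs]
  have hc : ∀ j : ℕ, Ring.multichoose (m + 1) (j + 1) =
      Ring.multichoose m (j + 1) + Ring.multichoose (m + 1) j := Ring.multichoose_succ_succ m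
  rw [Finset.sum_range_succ' (fun j : ℕ => Ring.multichoose (m + 1) j • f _),
    Finset.sum_range_succ' (fun j : ℕ => Ring.multichoose m j • f _),
    Finset.sum_range_succ' (fun j : ℕ => _ • Ring.multichoose m j • g _),
    Finset.sum_range_succ' (fun j : ℕ => _ • Ring.multichoose (m + 1) j • g _)]
  simp only [hc, add_smul, Nat.cast_add, Nat.cast_one, Ring.multichoose_zero_right, neg_smul,
    smul_add, Finset.sum_add_distrib, Finset.sum_neg_distrib]
  abel

theorem IsResidue.act (hzw : z ≠ w) (p : MvPolynomial κ ℂ) : ∀ {f g h : (κ → ℤ) → E},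
    IsResidue z w f g h → IsResidue z w (act p f) (act p g) (act (translateVar z w p) h) := by
  induction p using MvPolynomial.induction_on with
  | C c =>
    intro f g h hh
    simpa only [translateVar, MvPolynomial.bind₁_C_right, act_C] using hh.smul c
  | add p q hp hq =>
    intro f g h hh
    simpa only [map_add (translateVar z w), act_add] using (hp hh).add (hq hh)
  | mul_X p i hp =>
    intro f g h hh
    rw [map_mul (translateVar z w), act_mul, act_mul, act_mul]
    apply hp
    rcases eq_or_ne i z with rfl | hi
    · simpa [translateVar] using hh.act_X_self hzw
    · simpa [translateVar, hi] using hh.act_X_of_ne hi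

/-- Associativity from commutativity: if the two orderings become the same Laurent polynomial
after multiplication by `P(z, w)`, then the residue does so after multiplication by `P(x + w, w)`. -/
theorem IsResidue.act_eq_act_const (hzw : z ≠ w) {p q : MvPolynomial κ ℂ} {v : E}
    (hh : IsResidue z w f g h) (hf : FormalDist.act p f = FormalDist.act q (const v))
    (hg : FormalDist.act p g = FormalDist.act q (const v)) :
    FormalDist.act (translateVar z w p) h = FormalDist.act (translateVar z w q) (const v) := by
  have h₁ := hh.act hzw p
  rw [hf, hg] at h₁
  exact h₁.unique ((isResidue_const hzw v).act hzw q)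

end FormalDist

open FormalDist in
-- A residue only combines exponents differing by multiples of the direction z - w, so a family of
-- maps constant along it may be applied.
theorem FormalDist.IsResidue.map_of_invariant {κ E E' : Type*} [DecidableEq κ] [AddCommGroup E]
    [Module ℂ E] [AddCommGroup E'] [Module ℂ E'] {z w : κ} {f g h : (κ → ℤ) → E}
    (φ : (κ → ℤ) → E →ₗ[ℂ] E')
    (hφ : ∀ e (n : ℤ), φ (e + n • (Pi.single z 1 - Pi.single w 1)) = φ e)
    (hh : IsResidue z w f g h) :
    IsResidue z w (fun e => φ e (f e)) (fun e => φ e (g e)) (fun e => φ e (h e)) := by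
  intro e
  obtain ⟨K, hK⟩ := hh e
  have hφ' : ∀ n : ℤ, φ (e - n • (Pi.single z 1 - Pi.single w 1)) = φ e := fun n => by
    rw [sub_eq_add_neg, ← neg_smul, hφ]
  refine ⟨K, fun L hL L' hL' => ?_⟩
  simp only [hK L hL L' hL', map_add, map_sum, map_zsmul, hφ, hφ']

theorem Ring.succ_mul_multichoose_succ (r : ℤ) (k : ℕ) :
    ((k : ℤ) + 1) * Ring.multichoose r (k + 1) = (r + k) * Ring.multichoose r k := by
  have h₁ := Ring.factorial_nsmul_multichoose_eq_ascPochhammer r (k + 1)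
  have h₀ := Ring.factorial_nsmul_multichoose_eq_ascPochhammer r k
  rw [Polynomial.ascPochhammer_smeval_eq_eval] at h₀ h₁
  rw [ascPochhammer_succ_eval, ← h₀, Nat.factorial_succ] at h₁
  have hk : ((k.factorial : ℕ) : ℤ) ≠ 0 := by exact_mod_cast k.factorial_ne_zero
  apply mul_left_cancel₀ hk
  simp only [nsmul_eq_mul, Nat.cast_mul, Nat.cast_add, Nat.cast_one] at h₁
  linear_combination h₁

/-! ### Locality, Goddard uniqueness and the residue product -/

namespace VOA

open FormalDist MvPolynomial

variable {V : Type*} [AddCommGroup V] [Module ℂ V] (A : VOA V)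

/-- The coefficient of `z^k` in `Y(v, z)`. -/
noncomputable def mode (v : V) (k : ℤ) : V →ₗ[ℂ] V := HVertexOperator.coeff (A.Y v) k

theorem ncoeff_eq_mode (v : V) (n : ℤ) : (A.Y v)[[n]] = A.mode v (-n - 1) := rfl

theorem exists_mode_eq_zero (v u : V) : ∃ B : ℤ, ∀ k < B, A.mode v k u = 0 :=
  ⟨_, fun k hk => VertexOperator.coeff_eq_zero_of_lt_order (A.Y v) k u hk⟩

theorem mode_vac_of_neg (v : V) {k : ℤ} (hk : k < 0) : A.mode v k A.vac = 0 := by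
  have := (A.creativity v).1 (-k - 1) (by omega)
  rwa [ncoeff_eq_mode, neg_sub, sub_neg_eq_add, add_sub_cancel_left] at this

theorem mode_zero_vac (v : V) : A.mode v 0 A.vac = v := by
  simpa [ncoeff_eq_mode] using (A.creativity v).2

theorem L_eq_mode (n : ℤ) : A.L n = A.mode A.omega (-n - 2) := by
  rw [L, ncoeff_eq_mode, show -(n + 1) - 1 = -n - 2 by ring]

theorem L_neg_one_mode (v : V) (k : ℤ) (u : V) :
    A.L (-1) (A.mode v k u) = A.mode v k (A.L (-1) u) + ((k : ℂ) + 1) • A.mode v (k + 1) u := by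
  have := LinearMap.congr_fun (A.translation v (-k - 1)) u
  simp only [LinearMap.sub_apply, Module.End.mul_apply, LinearMap.smul_apply, A.ncoeff_eq_mode v] at this
  rw [sub_eq_iff_eq_add', neg_sub, sub_neg_eq_add, add_sub_cancel_left] at this
  rw [L, this]
  congr 2
  · push_cast; ring
  · rw [show -(-k - 1 - 1) - 1 = k + 1 by ring]

theorem L_neg_one_vac : A.L (-1) A.vac = 0 := by
  rw [L_eq_mode]; exact A.mode_vac_of_neg _ (by norm_num)

theorem L_neg_one_mode_vac (v : V) (k : ℤ) :
    A.L (-1) (A.mode v k A.vac) = ((k : ℂ) + 1) • A.mode v (k + 1) A.vac := by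
  rw [L_neg_one_mode, L_neg_one_vac, map_zero, zero_add]

/-- A power series `F(w)` with `L₋₁ F(w) = ∂_w F(w)` is determined by its constant term. -/
theorem eq_of_L_neg_one {F G : ℤ → V} (hF : ∀ k < 0, F k = 0) (hG : ∀ k < 0, G k = 0)
    (h₀ : F 0 = G 0) (hF' : ∀ k : ℕ, A.L (-1) (F k) = ((k : ℂ) + 1) • F (k + 1))
    (hG' : ∀ k : ℕ, A.L (-1) (G k) = ((k : ℂ) + 1) • G (k + 1)) (k : ℤ) : F k = G k := by
  rcases lt_or_ge k 0 with hk | hk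
  · rw [hF k hk, hG k hk]
  · lift k to ℕ using hk
    induction k with
    | zero => exact h₀
    | succ k ih =>
      have := hF' k
      rw [ih, hG' k] at this
      have hk : (k : ℂ) + 1 ≠ 0 := by exact_mod_cast k.succ_ne_zero
      exact_mod_cast (smul_right_injective V hk this).symm

section Locality

variable {κ : Type*} [DecidableEq κ] {E : Type*} [AddCommGroup E] [Module ℂ E]

/-- An order of the pole at `z₁ = z₂` of the fields of `u` and `v`. -/
noncomputable def poleOrder (u v : V) : ℕ := (A.locality u v).choose

/-- The locality axiom inside a larger product: `φ` and `c` stand for the fields to the left and to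
the right, which do not involve the variables a and b. -/
theorem act_mode_comm (u v : V) {a b : κ} (hab : a ≠ b) (φ : (κ → ℤ) → V →ₗ[ℂ] E)
    (c : (κ → ℤ) → V) (hφ : ∀ e s t, φ (e - Pi.single a s - Pi.single b t) = φ e)
    (hc : ∀ e s t, c (e - Pi.single a s - Pi.single b t) = c e) {N : ℕ}
    (hN : A.poleOrder u v ≤ N) :
    act ((X a - X b) ^ N) (fun e => φ e (A.mode u (e a) (A.mode v (e b) (c e)))) =
      act ((X a - X b) ^ N) (fun e => φ e (A.mode v (e b) (A.mode u (e a) (c e)))) := by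
  obtain ⟨k, rfl⟩ := Nat.exists_eq_add_of_le' hN
  rw [pow_add, act_mul, act_mul]
  congr 1
  funext e
  rw [act_sub_pow, act_sub_pow, ← sub_eq_zero, ← Finset.sum_sub_distrib]
  have h := congrArg (fun T => φ e (T (c e)))
    ((A.locality u v).choose_spec (-e a - 1) (-e b - 1))
  simp only [LinearMap.coe_sum, Finset.sum_apply, LinearMap.zero_apply, map_zero, map_sum,
    LinearMap.smul_apply, map_smul, LinearMap.sub_apply, Module.End.mul_apply, map_sub,
    ncoeff_eq_mode] at h
  rw [← h]
  refine Finset.sum_congr rfl fun j _ => ?_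
  have ha : (e - Pi.single a ((A.poleOrder u v : ℤ) - j) - Pi.single b (j : ℤ) : κ → ℤ) a =
      -(-e a - 1 + (A.poleOrder u v : ℤ) - j) - 1 := by simp [hab]; omega
  have hb : (e - Pi.single a ((A.poleOrder u v : ℤ) - j) - Pi.single b (j : ℤ) : κ → ℤ) b =
      -(-e b - 1 + j) - 1 := by simp [hab.symm]; omega
  rw [hφ, hc, ha, hb, ← smul_sub]
  rfl

end Locality

/-- `F(w)` is local with respect to all fields, when applied to the vacuum. -/
def IsVacLocal (F : ℤ → V → V) : Prop :=
  ∀ c : V, ∃ M : ℕ, act ((X 0 - X 1 : MvPolynomial (Fin 2) ℂ) ^ M)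
    (fun e => F (e 1) (A.mode c (e 0) A.vac) - A.mode c (e 0) (F (e 1) A.vac)) = 0

/-- Goddard's uniqueness theorem. -/
theorem eq_of_isVacLocal {F G : ℤ → V → V} (hF : A.IsVacLocal F) (hG : A.IsVacLocal G)
    (hF₀ : ∀ k, F k 0 = 0) (hG₀ : ∀ k, G k 0 = 0) (h : ∀ k, F k A.vac = G k A.vac) : F = G := by
  funext k c
  obtain ⟨M, hM⟩ := hF c
  obtain ⟨M', hM'⟩ := hG c
  have hd : act ((X 0 - X 1 : MvPolynomial (Fin 2) ℂ) ^ (M + M'))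
      (fun e => F (e 1) (A.mode c (e 0) A.vac) - G (e 1) (A.mode c (e 0) A.vac)) = 0 := by
    have : (fun e : Fin 2 → ℤ => F (e 1) (A.mode c (e 0) A.vac) - G (e 1) (A.mode c (e 0) A.vac)) =
        (fun e => F (e 1) (A.mode c (e 0) A.vac) - A.mode c (e 0) (F (e 1) A.vac)) -
        (fun e => G (e 1) (A.mode c (e 0) A.vac) - A.mode c (e 0) (G (e 1) A.vac)) := by
      funext e
      simp only [Pi.sub_apply, h]
      abel
    rw [this, map_sub, pow_add, act_mul, act_mul, hM', map_zero, sub_zero, act_comm, hM, map_zero]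
  -- This amounts to setting z₀ = 0. Any term with j < M + M' applies a mode of c of negative
  -- exponent to the vacuum; the last one contains c itself.
  have h0 := congrFun hd ![0, k + (M + M' : ℕ)]
  rw [act_sub_pow, Finset.sum_eq_single_of_mem (M + M') (by simp)] at h0
  · simpa [mode_zero_vac, sub_eq_zero] using h0
  · intro j hj hj'
    have hj : j < M + M' := by
      have := Finset.mem_range.1 hj; omega
    have h0 : (![0, k + (M + M' : ℕ)] - Pi.single 0 (((M + M' : ℕ) : ℤ) - j) -
        Pi.single 1 (j : ℤ) : Fin 2 → ℤ) 0 < 0 := by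
      rw [Pi.sub_apply, Pi.sub_apply, Pi.single_eq_same,
        Pi.single_eq_of_ne (by decide : (0 : Fin 2) ≠ 1), Matrix.cons_val_zero]
      omega
    rw [A.mode_vac_of_neg c h0, hF₀, hG₀, sub_zero, smul_zero]

theorem mode_isVacLocal (v : V) : A.IsVacLocal fun k u => A.mode v k u := by
  intro c
  refine ⟨A.poleOrder c v, ?_⟩
  have := A.act_mode_comm c v (κ := Fin 2) (a := 0) (b := 1) (by decide)
    (fun _ => LinearMap.id) (fun _ => A.vac) (fun _ _ _ => rfl) (fun _ _ _ => rfl) le_rfl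
  rw [← sub_eq_zero, ← map_sub, ← neg_eq_zero, ← map_neg, neg_sub] at this
  exact this

/-- Y(𝟏, w) = 1 is not among the axioms. It follows from Goddard's theorem, since the identity is
local with everything and agrees with Y(𝟏, w) on the vacuum. -/
theorem mode_vac (k : ℤ) (c : V) : A.mode A.vac k c = if k = 0 then c else 0 := by
  have := A.eq_of_isVacLocal (G := fun k c => if k = 0 then c else 0) (A.mode_isVacLocal A.vac)
    (fun c => ⟨0, ?_⟩) (fun k => map_zero _) (fun k => by simp) (fun k => ?_)
  · exact congrFun (congrFun this k) c
  · funext e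
    simp only [pow_zero, map_one, Module.End.one_apply, Pi.zero_apply]
    split_ifs <;> simp
  · refine A.eq_of_L_neg_one (F := fun k => A.mode A.vac k A.vac)
      (G := fun k => if k = 0 then A.vac else 0) (fun k hk => A.mode_vac_of_neg _ hk)
      (fun k hk => if_neg hk.ne) (by simpa using A.mode_zero_vac _)
      (fun k => A.L_neg_one_mode_vac _ k) (fun k => ?_) k
    rw [if_neg (by omega : (k : ℤ) + 1 ≠ 0)]
    split_ifs <;> simp [L_neg_one_vac]

/-- The coefficient of `x^m w^k` in
`Res_z ((z - w - x)⁻¹ Y(a, z) Y(b, w) c - (-w + z - x)⁻¹ Y(b, w) Y(a, z) c)`. -/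
noncomputable def resProd (a b : V) (m k : ℤ) (c : V) : V :=
  (∑ᶠ j : ℕ, Ring.multichoose (m + 1) j • A.mode a (m + j) (A.mode b (k - j) c)) +
    ∑ᶠ j : ℕ, (m.negOnePow : ℤ) • Ring.multichoose (m + 1) j •
      A.mode b (k + (m + 1 + j)) (A.mode a (-1 - j) c)

theorem resProd_apply_zero (a b : V) (m k : ℤ) : A.resProd a b m k 0 = 0 := by
  simp [resProd]

theorem isResidue_resProd_of_const {κ : Type*} [DecidableEq κ] (a : V) {z w : κ} (hzw : z ≠ w)
    (b c : (κ → ℤ) → V)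
    (hb : ∀ e (n : ℤ), b (e + n • (Pi.single z 1 - Pi.single w 1)) = b e)
    (hc : ∀ e (n : ℤ), c (e + n • (Pi.single z 1 - Pi.single w 1)) = c e) :
    IsResidue z w (fun e => A.mode a (e z) (A.mode (b e) (e w) (c e)))
      (fun e => A.mode (b e) (e w) (A.mode a (e z) (c e)))
      (fun e => A.resProd a (b e) (e z) (e w) (c e)) := by
  intro e
  obtain ⟨B, hB⟩ := A.exists_mode_eq_zero (b e) (c e)
  obtain ⟨B', hB'⟩ := A.exists_mode_eq_zero a (c e)
  have hc' : ∀ n : ℤ, c (e - n • (Pi.single z 1 - Pi.single w 1)) = c e := fun n => by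
    rw [sub_eq_add_neg, ← neg_smul, hc]
  have hb' : ∀ n : ℤ, b (e - n • (Pi.single z 1 - Pi.single w 1)) = b e := fun n => by
    rw [sub_eq_add_neg, ← neg_smul, hb]
  -- Beyond this index the mode of b has exponent e w - j < B and the mode of a has exponent -1 - j
  -- < B'.
  refine ⟨(e w - B).toNat + 1 + (-1 - B').toNat + 1, fun K hK K' hK' => ?_⟩
  simp only [resProd]
  rw [finsum_eq_sum_of_support_subset (s := Finset.range K),
    finsum_eq_sum_of_support_subset (s := Finset.range K')]
  · congr 1
    · refine Finset.sum_congr rfl fun j _ => ?_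
      rw [hc, hb]
      simp [hzw, hzw.symm, sub_eq_add_neg]
    · refine Finset.sum_congr rfl fun j _ => ?_
      rw [hc', hb']
      have h₁ : (e - (e z + 1 + (j : ℤ)) • (Pi.single z 1 - Pi.single w 1) : κ → ℤ) z = -1 - (j : ℤ) := by
        simp [hzw]; omega
      have h₂ : (e - (e z + 1 + (j : ℤ)) • (Pi.single z 1 - Pi.single w 1) : κ → ℤ) w =
          e w + (e z + 1 + (j : ℤ)) := by
        simp [hzw.symm]; omega
      rw [h₁, h₂]
  · rw [Function.support_subset_iff']
    intro j hj
    rw [Finset.mem_coe, Finset.mem_range] at hj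
    rw [hB' _ (by omega), map_zero, smul_zero, smul_zero]
  · rw [Function.support_subset_iff']
    intro j hj
    rw [Finset.mem_coe, Finset.mem_range] at hj
    rw [hB _ (by omega), map_zero, smul_zero]

theorem isResidue_resProd {κ E : Type*} [DecidableEq κ] [AddCommGroup E] [Module ℂ E] (a : V)
    {z w : κ} (hzw : z ≠ w) (φ : (κ → ℤ) → V →ₗ[ℂ] E) (b c : (κ → ℤ) → V)
    (hb : ∀ e (n : ℤ), b (e + n • (Pi.single z 1 - Pi.single w 1)) = b e)
    (hφ : ∀ e (n : ℤ), φ (e + n • (Pi.single z 1 - Pi.single w 1)) = φ e)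
    (hc : ∀ e (n : ℤ), c (e + n • (Pi.single z 1 - Pi.single w 1)) = c e) :
    IsResidue z w (fun e => φ e (A.mode a (e z) (A.mode (b e) (e w) (c e))))
      (fun e => φ e (A.mode (b e) (e w) (A.mode a (e z) (c e))))
      (fun e => φ e (A.resProd a (b e) (e z) (e w) (c e))) :=
  (A.isResidue_resProd_of_const a hzw b c hb hc).map_of_invariant φ hφ

/-- For n = -1 - m at least the pole order, (z - w)^n makes the two orderings equal. The factor
becomes x^n on the residue, so the coefficient sought is that of x⁻¹ after multiplication. -/
theorem resProd_eq_zero (a b : V) {m : ℤ} (hm : m < -(A.poleOrder a b : ℤ)) (k : ℤ) (c : V) :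
    A.resProd a b m k c = 0 := by
  obtain ⟨n, hn⟩ : ∃ n : ℕ, m = -1 - n := ⟨(-1 - m).toNat, by omega⟩
  have hzw : (0 : Fin 2) ≠ 1 := by decide
  have hres := (A.isResidue_resProd (κ := Fin 2) a hzw (fun _ => LinearMap.id) (fun _ => b)
    (fun _ => c) (fun _ _ => rfl) (fun _ _ => rfl) (fun _ _ => rfl)).act hzw ((X 0 - X 1) ^ n)
  rw [A.act_mode_comm a b hzw (fun _ => LinearMap.id) (fun _ => c) (fun _ _ _ => rfl)
    (fun _ _ _ => rfl) (by omega : A.poleOrder a b ≤ n)] at hres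
  have ht : translateVar (0 : Fin 2) 1 ((X 0 - X 1) ^ n) = X 0 ^ n := by
    simp [translateVar]
  have hX : ∀ (n : ℕ) (f : (Fin 2 → ℤ) → V) (e : Fin 2 → ℤ),
      act (X 0 ^ n) f e = f (e - Pi.single 0 (n : ℤ)) := by
    intro n f
    induction n with
    | zero => simp
    | succ n ih =>
      intro e
      rw [pow_succ', act_mul, act_X, ih, sub_sub, ← Pi.single_add]
      push_cast; rw [add_comm]
  -- At x⁻¹ the kernel is (z - w)^0 = 1 in both expansions, with opposite signs, so the equal
  -- orderings cancel.
  obtain ⟨K, hK⟩ := hres ![-1, k]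
  have h := hK (K + 1) (by omega) (K + 1) (by omega)
  rw [ht, hX, Finset.sum_range_succ', Finset.sum_range_succ'] at h
  simpa [Ring.multichoose_zero_succ, hn] using h

end VOA

/-! ### Dong's lemma and the iterate formula -/

namespace VOA

open FormalDist MvPolynomial

variable {V : Type*} [AddCommGroup V] [Module ℂ V] (A : VOA V)

/-- The residue products of two fields are local, jointly for bounded exponents of `x`. -/
theorem act_resProd_comm (a b c : V) (t : ℕ) :
    ∃ M : ℕ, ∀ e : Fin 3 → ℤ, e 0 < t - (A.poleOrder a b : ℤ) →
      act ((X 2 - X 1 : MvPolynomial (Fin 3) ℂ) ^ M)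
        (fun e => A.resProd a b (e 0) (e 1) (A.mode c (e 2) A.vac) -
          A.mode c (e 2) (A.resProd a b (e 0) (e 1) A.vac)) e = 0 := by
  have hzw : (0 : Fin 3) ≠ 1 := by decide
  set D : (Fin 3 → ℤ) → V := fun e => A.resProd a b (e 0) (e 1) (A.mode c (e 2) A.vac) -
          A.mode c (e 2) (A.resProd a b (e 0) (e 1) A.vac) with hD
  set N₁ := A.poleOrder c a
  set N₂ := A.poleOrder c b
  set p : MvPolynomial (Fin 3) ℂ := X 2 - X 1 with hp
  -- The field of c moves leftwards past both other fields, at the cost of one locality factor for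
  -- each.
  have hcomm : ∀ u v : V, ∀ i j : Fin 3, 2 ≠ i → 2 ≠ j → i ≠ j →
      act ((X 2 - X i : MvPolynomial (Fin 3) ℂ) ^ A.poleOrder c u *
          (X 2 - X j : MvPolynomial (Fin 3) ℂ) ^ A.poleOrder c v)
        (fun e => A.mode u (e i) (A.mode v (e j) (A.mode c (e 2) A.vac))) =
      act ((X 2 - X i : MvPolynomial (Fin 3) ℂ) ^ A.poleOrder c u *
          (X 2 - X j : MvPolynomial (Fin 3) ℂ) ^ A.poleOrder c v)
        (fun e => A.mode c (e 2) (A.mode u (e i) (A.mode v (e j) A.vac))) := by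
    intro u v i j hi hj hij
    have hi' := A.act_mode_comm c u hi (fun e => LinearMap.id)
      (fun e => A.mode v (e j) A.vac) (fun _ _ _ => rfl) (fun e s t => by simp [hij.symm, hj.symm])
      le_rfl
    simp only [LinearMap.id_apply] at hi'
    rw [act_mul, ← A.act_mode_comm c v hj (fun e => A.mode u (e i)) (fun _ => A.vac) _
      (fun _ _ _ => rfl) le_rfl, act_comm, ← hi', act_comm, ← act_mul]
    · intro e s t; simp [hij, hi.symm]
  have h₁ := A.isResidue_resProd a hzw (fun _ => LinearMap.id) (fun _ => b)
    (fun e => A.mode c (e 2) A.vac) (fun _ _ => rfl) (fun _ _ => rfl) (fun e n => by simp)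
  have h₂ := (A.isResidue_resProd a hzw (fun e => A.mode c (e 2)) (fun _ => b)
    (fun _ => A.vac) (fun _ _ => rfl) (fun e n => by simp) (fun _ _ => rfl)).smul (-1)
  have h₃ := (h₁.add h₂).act hzw ((X 2 - X 0) ^ N₁ * (X 2 - X 1) ^ N₂)
  have hz : ∀ f : (Fin 3 → ℤ) → V, f + (-1 : ℂ) • f = 0 := fun f => by simp
  -- `D` is a residue of two differences that vanish after multiplication by the locality factors.
  -- Under z ↦ x + w these factors become powers of p - x and p.
  have hD' : act ((p - X 0) ^ N₁ * p ^ N₂) D = 0 := by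
    have ht : translateVar (0 : Fin 3) 1 ((X 2 - X 0) ^ N₁ * (X 2 - X 1) ^ N₂) =
        (p - X 0) ^ N₁ * p ^ N₂ := by
      simp [translateVar, hp, sub_sub, add_comm]
    have hD : D = (fun e => (LinearMap.id : V →ₗ[ℂ] V) (A.resProd a b (e 0) (e 1) (A.mode c (e 2) A.vac))) +
        (-1 : ℂ) • fun e => A.mode c (e 2) (A.resProd a b (e 0) (e 1) A.vac) := by
      funext e; simp [D, sub_eq_add_neg]
    rw [ht, ← hD, map_add, map_add, map_smul, map_smul] at h₃
    have hf := hcomm a b 0 1 (by decide) (by decide) (by decide)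
    have hg := hcomm b a 1 0 (by decide) (by decide) (by decide)
    rw [mul_comm] at hg
    simp only [LinearMap.id_apply] at h₃
    rw [hf, hg, hz, hz] at h₃
    refine h₃.unique fun e => ⟨0, fun _ _ _ _ => by simp⟩
  -- Modulo x, (p - x)^N₁ is p^N₁. So a power of p acts on `D` as a multiple of x, which involves
  -- only lower exponents of x. Induction on the exponent starts below the pole order, where `D`
  -- vanishes.
  obtain ⟨q, hq⟩ : (X 0 : MvPolynomial (Fin 3) ℂ) ∣ (p - X 0) ^ N₁ - p ^ N₁ := by
    have := sub_dvd_pow_sub_pow (p - X 0) p N₁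
    rwa [sub_sub_cancel_left, neg_dvd] at this
  induction t with
  | zero =>
    refine ⟨0, fun e he => ?_⟩
    have he : e 0 < -(A.poleOrder a b : ℤ) := by simpa using he
    simp [D, A.resProd_eq_zero a b he]
  | succ t ih =>
    obtain ⟨M, hM⟩ := ih
    refine ⟨N₁ + N₂ + M, fun e he => ?_⟩
    have hpow : p ^ (N₁ + N₂ + M) = p ^ M * ((p - X 0) ^ N₁ * p ^ N₂) - X 0 * (q * p ^ N₂ * p ^ M) := by
      have : (p - X 0) ^ N₁ = p ^ N₁ + X 0 * q := by rw [← hq]; ring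
      rw [this]; ring
    rw [hpow, map_sub, LinearMap.sub_apply, act_mul, hD', map_zero, zero_sub, Pi.neg_apply,
      neg_eq_zero, act_mul, act_X, act_mul]
    refine act_eq_zero_of_stable (S := {e | e 0 < t - (A.poleOrder a b : ℤ)}) _ ?_ hM _ ?_
    · intro e he s
      simp only [Set.mem_ofPred_eq] at he ⊢
      omega
    · simp only [Set.mem_ofPred_eq, Pi.sub_apply, Pi.single_eq_same]
      push_cast at he
      omega

/-- Dong's lemma. -/
theorem resProd_isVacLocal (a b : V) (m : ℤ) : A.IsVacLocal fun k u => A.resProd a b m k u := by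
  intro c
  obtain ⟨M, hM⟩ := A.act_resProd_comm a b c (m + 1 + A.poleOrder a b).toNat
  refine ⟨M, ?_⟩
  funext e
  have := hM ![m, e 1, e 0] (by simp only [Matrix.cons_val_zero]; omega)
  rw [act_sub_pow] at this ⊢
  rw [Pi.zero_apply, ← this]
  refine Finset.sum_congr rfl fun j _ => ?_
  have h0 : (![m, e 1, e 0] - Pi.single 2 ((M : ℤ) - j) - Pi.single 1 (j : ℤ) : Fin 3 → ℤ) 0 = m := by
    rw [Pi.sub_apply, Pi.sub_apply, Pi.single_eq_of_ne (by decide), Pi.single_eq_of_ne (by decide)]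
    simp
  have h1 : (![m, e 1, e 0] - Pi.single 2 ((M : ℤ) - j) - Pi.single 1 (j : ℤ) : Fin 3 → ℤ) 1 =
      (e - Pi.single 0 ((M : ℤ) - j) - Pi.single 1 (j : ℤ) : Fin 2 → ℤ) 1 := by
    rw [Pi.sub_apply, Pi.sub_apply, Pi.sub_apply, Pi.sub_apply, Pi.single_eq_of_ne (by decide),
      Pi.single_eq_same, Pi.single_eq_of_ne (by decide), Pi.single_eq_same]
    simp
  have h2 : (![m, e 1, e 0] - Pi.single 2 ((M : ℤ) - j) - Pi.single 1 (j : ℤ) : Fin 3 → ℤ) 2 =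
      (e - Pi.single 0 ((M : ℤ) - j) - Pi.single 1 (j : ℤ) : Fin 2 → ℤ) 0 := by
    rw [Pi.sub_apply, Pi.sub_apply, Pi.sub_apply, Pi.sub_apply, Pi.single_eq_same,
      Pi.single_eq_of_ne (by decide), Pi.single_eq_same, Pi.single_eq_of_ne (by decide)]
    simp
  simp only [h0, h1, h2]

theorem resProd_vac (a b : V) (m k : ℤ) :
    A.resProd a b m k A.vac =
      if 0 ≤ k then ∑ j ∈ Finset.range (k.toNat + 1),
        Ring.multichoose (m + 1) j • A.mode a (m + j) (A.mode b (k - j) A.vac) else 0 := by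
  have h₂ : ∀ j : ℕ, A.mode a (-1 - j) A.vac = 0 := fun j => A.mode_vac_of_neg _ (by omega)
  simp only [resProd, h₂, map_zero, smul_zero, finsum_zero, add_zero]
  split_ifs with hk
  · rw [finsum_eq_sum_of_support_subset]
    rw [Function.support_subset_iff']
    intro j hj
    rw [Finset.mem_coe, Finset.mem_range] at hj
    rw [A.mode_vac_of_neg b (by omega), map_zero, smul_zero]
  · apply finsum_eq_zero_of_forall_eq_zero
    intro j
    rw [A.mode_vac_of_neg b (by omega), map_zero, smul_zero]

/-- L₋₁ acts as ∂_z + ∂_w on the product of the two fields applied to the vacuum. The kernel depends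
on z - w only, so integration by parts leaves ∂_w of the residue. On coefficients this is
`Ring.succ_mul_multichoose_succ`. -/
theorem L_neg_one_resProd_vac (a b : V) (m : ℤ) (k : ℕ) :
    A.L (-1) (A.resProd a b m k A.vac) = ((k : ℂ) + 1) • A.resProd a b m (k + 1) A.vac := by
  rw [resProd_vac, resProd_vac, if_pos (by positivity), if_pos (by positivity), map_sum,
    Finset.smul_sum]
  have hk : ((k : ℤ) + 1).toNat + 1 = (k + 1) + 1 := by omega
  rw [hk, Int.toNat_natCast]
  have hT : ∀ j : ℕ, A.L (-1) (Ring.multichoose (m + 1) j • A.mode a (m + j) (A.mode b (k - j) A.vac)) =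
      ((m + (j + 1 : ℕ)) * Ring.multichoose (m + 1) j) •
          A.mode a (m + (j + 1 : ℕ)) (A.mode b (k + 1 - (j + 1 : ℕ)) A.vac) +
        ((k + 1 - j) * Ring.multichoose (m + 1) j) •
          A.mode a (m + j) (A.mode b (k + 1 - j) A.vac) := by
    intro j
    rw [map_zsmul, L_neg_one_mode, L_neg_one_mode_vac, map_smul, smul_add, add_comm]
    have h₁ : (((m + j : ℤ) : ℂ) + 1) = ((m + (j + 1 : ℕ) : ℤ) : ℂ) := by push_cast; ring
    have h₂ : (((k - j : ℤ) : ℂ) + 1) = ((k + 1 - j : ℤ) : ℂ) := by push_cast; ring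
    rw [h₁, h₂, Int.cast_smul_eq_zsmul, Int.cast_smul_eq_zsmul, ← mul_smul, ← mul_smul, mul_comm,
      mul_comm (Ring.multichoose (m + 1) j)]
    congr 3
    · push_cast; ring_nf
    · push_cast; ring_nf
    · ring_nf
  simp only [hT, Finset.sum_add_distrib]
  have hR : ∀ j : ℕ, ((k : ℂ) + 1) • Ring.multichoose (m + 1) j •
        A.mode a (m + j) (A.mode b (k + 1 - j) A.vac) =
      (j * Ring.multichoose (m + 1) j : ℤ) • A.mode a (m + j) (A.mode b (k + 1 - j) A.vac) +
        ((k + 1 - j) * Ring.multichoose (m + 1) j) •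
          A.mode a (m + j) (A.mode b (k + 1 - j) A.vac) := by
    intro j
    have : ((k : ℂ) + 1) = ((k + 1 : ℤ) : ℂ) := by push_cast; ring
    rw [this, Int.cast_smul_eq_zsmul, ← mul_smul, ← add_smul]
    congr 1; ring
  simp only [hR, Finset.sum_add_distrib]
  congr 1
  · rw [Finset.sum_range_succ' _ (k + 1)]
    simp only [Nat.cast_zero, zero_mul, zero_smul, add_zero]
    refine Finset.sum_congr rfl fun j _ => ?_
    congr 1
    have := Ring.succ_mul_multichoose_succ (m + 1) j
    push_cast
    linear_combination -this
  · rw [Finset.sum_range_succ _ (k + 1)]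
    simp

/-- The iterate formula. -/
theorem mode_mode (a b : V) (m k : ℤ) (c : V) :
    A.mode (A.mode a m b) k c = A.resProd a b m k c := by
  have := A.eq_of_isVacLocal (A.mode_isVacLocal (A.mode a m b)) (A.resProd_isVacLocal a b m)
    (fun k => map_zero _) (fun k => A.resProd_apply_zero a b m k) (fun k => ?_)
  · exact congrFun (congrFun this k) c
  · refine A.eq_of_L_neg_one (F := fun k => A.mode (A.mode a m b) k A.vac)
      (G := fun k => A.resProd a b m k A.vac) (fun k hk => A.mode_vac_of_neg _ hk)
      (fun k hk => ?_) ?_ (fun k => A.L_neg_one_mode_vac _ k)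
      (fun k => A.L_neg_one_resProd_vac a b m k) k
    · rw [resProd_vac, if_neg (by omega)]
    · simp only [resProd_vac, mode_zero_vac]
      simp [mode_zero_vac]

theorem isResidue_mode_mode {κ E : Type*} [DecidableEq κ] [AddCommGroup E] [Module ℂ E] (a : V)
    {z w : κ} (hzw : z ≠ w) (φ : (κ → ℤ) → V →ₗ[ℂ] E) (b c : (κ → ℤ) → V)
    (hb : ∀ e (n : ℤ), b (e + n • (Pi.single z 1 - Pi.single w 1)) = b e)
    (hφ : ∀ e (n : ℤ), φ (e + n • (Pi.single z 1 - Pi.single w 1)) = φ e)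
    (hc : ∀ e (n : ℤ), c (e + n • (Pi.single z 1 - Pi.single w 1)) = c e) :
    IsResidue z w (fun e => φ e (A.mode a (e z) (A.mode (b e) (e w) (c e))))
      (fun e => φ e (A.mode (b e) (e w) (A.mode a (e z) (c e))))
      (fun e => φ e (A.mode (A.mode a (e z) (b e)) (e w) (c e))) := by
  simpa only [mode_mode] using A.isResidue_resProd a hzw φ b c hb hφ hc

end VOA

namespace VOA

open FormalDist MvPolynomial

variable {V : Type*} [AddCommGroup V] [Module ℂ V] (A : VOA V)

/-! ### The dual vacuum on Virasoro descendants -/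

theorem component_of_mem {i n : ℤ} (hi : i ≠ n) {v : V} (hv : v ∈ A.grade i) :
    A.component n v = 0 := by
  have : v = DirectSum.coeLinearMap A.grade (DirectSum.lof ℂ ℤ (fun i => A.grade i) i ⟨v, hv⟩) := by
    rw [DirectSum.coeLinearMap_lof]
  rw [component, LinearMap.comp_apply]
  have h2 : (LinearEquiv.ofBijective (DirectSum.coeLinearMap A.grade)
      A.bijective_coeLinearMap).symm.toLinearMap v =
      DirectSum.lof ℂ ℤ (fun i => A.grade i) i ⟨v, hv⟩ := by
    rw [LinearEquiv.coe_coe, LinearEquiv.symm_apply_eq]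
    exact this
  rw [h2, DirectSum.component.of, dif_neg hi]

variable {A} in
-- L₀ is multiplication by n on V_n, and 𝟏' sees only V₀. Hence 𝟏' kills every L₀-eigenvector of
-- nonzero eigenvalue, which is how weights are used below.
theorem vacDual_L_zero (h : A.IsCFTType) (v : V) : vacDual h (A.L 0 v) = 0 := by
  have hv : v ∈ ⨆ i, A.grade i := by
    rw [A.isInternal.submodule_iSup_eq_top]; trivial
  induction hv using Submodule.iSup_induction' with
  | mem i v hv =>
    have : A.L 0 v = (i : ℂ) • v := A.L_zero i v hv
    rw [this, map_smul]
    rcases eq_or_ne i 0 with rfl | hi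
    · simp
    · rw [vacDual, LinearMap.comp_apply, LinearMap.comp_apply, A.component_of_mem hi hv, map_zero,
        map_zero, smul_zero]
  | zero => simp
  | add x y _ _ hx hy => rw [map_add, map_add, hx, hy, add_zero]

theorem L_zero_vac : A.L 0 A.vac = 0 := by
  rw [L_eq_mode]; exact A.mode_vac_of_neg _ (by norm_num)

theorem L_L (m n : ℤ) (u : V) : A.L m (A.L n u) = A.L n (A.L m u) + ((m : ℂ) - n) • A.L (m + n) u +
    (if m = -n then ((m : ℂ) ^ 3 - m) / 12 * A.charge else 0) • u := by
  have := LinearMap.congr_fun (A.virasoro m n) u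
  rw [LinearMap.sub_apply, sub_eq_iff_eq_add'] at this
  rw [add_assoc]
  exact this

theorem L_zero_L {n s : ℤ} {u : V} (hu : A.L 0 u = (s : ℂ) • u) :
    A.L 0 (A.L n u) = ((s - n : ℤ) : ℂ) • A.L n u := by
  rw [L_L, hu, map_smul, zero_add]
  have : (if (0 : ℤ) = -n then (((0 : ℤ) : ℂ) ^ 3 - (0 : ℤ)) / 12 * A.charge else 0) = 0 := by
    split_ifs <;> simp
  rw [this, zero_smul, add_zero, ← add_smul]
  congr 1; push_cast; ring

/-- Vectors `L_{n₁} ⋯ L_{nᵣ} 𝟏` of weight `s` with all `nᵢ ≤ -2`. -/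
inductive IsLoweringWord : ℤ → V → Prop
  | vac : IsLoweringWord 0 A.vac
  | L {s : ℤ} {u : V} (n : ℤ) (hn : n ≤ -2) (hu : IsLoweringWord s u) :
      IsLoweringWord (s - n) (A.L n u)

/-- The Virasoro submodule generated by the vacuum. -/
def vacModule : Submodule ℂ V := Submodule.span ℂ {u | ∃ s, A.IsLoweringWord s u}

variable {A} in
theorem IsLoweringWord.L_zero {s : ℤ} {u : V} (hu : A.IsLoweringWord s u) :
    A.L 0 u = (s : ℂ) • u := by
  induction hu with
  | vac => simp [L_zero_vac]
  | L n _ _ ih => exact A.L_zero_L ih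

variable {A} in
theorem IsLoweringWord.eq_vac_or {s : ℤ} {u : V} (hu : A.IsLoweringWord s u) :
    (s = 0 ∧ u = A.vac) ∨ 2 ≤ s := by
  induction hu with
  | vac => exact Or.inl ⟨rfl, rfl⟩
  | L n hn _ ih => right; omega

theorem vac_mem_vacModule : A.vac ∈ A.vacModule := Submodule.subset_span ⟨0, .vac⟩

theorem L_vac_of_le {n : ℤ} (hn : -1 ≤ n) : A.L n A.vac = 0 := by
  rw [L_eq_mode]; exact A.mode_vac_of_neg _ (by omega)

theorem L_mem_of_le {n : ℤ} (hn : n ≤ -2) {u : V} (hu : u ∈ A.vacModule) :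
    A.L n u ∈ A.vacModule := by
  induction hu using Submodule.span_induction with
  | mem u hu => obtain ⟨s, hs⟩ := hu; exact Submodule.subset_span ⟨_, hs.L n hn⟩
  | zero => simp
  | add x y _ _ hx hy => rw [map_add]; exact add_mem hx hy
  | smul c x _ hx => rw [map_smul]; exact Submodule.smul_mem _ _ hx

variable {A} in
-- L_n is commuted past the leftmost lowering operator; the commutator is a multiple of one L plus a
-- scalar, so induction on the word applies.
theorem IsLoweringWord.L_mem {s : ℤ} {u : V} (hu : A.IsLoweringWord s u) :
    ∀ n, A.L n u ∈ A.vacModule := by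
  induction hu with
  | vac =>
    intro n
    rcases le_or_gt n (-2) with hn | hn
    · exact A.L_mem_of_le hn A.vac_mem_vacModule
    · rw [A.L_vac_of_le (by omega)]; exact zero_mem _
  | L k hk hu ih =>
    intro n
    rw [L_L]
    exact add_mem (add_mem (A.L_mem_of_le hk (ih n)) (Submodule.smul_mem _ _ (ih _)))
      (Submodule.smul_mem _ _ (Submodule.subset_span ⟨_, hu⟩))

theorem L_mem_vacModule (n : ℤ) {u : V} (hu : u ∈ A.vacModule) : A.L n u ∈ A.vacModule := by
  induction hu using Submodule.span_induction with
  | mem u hu => obtain ⟨s, hs⟩ := hu; exact hs.L_mem n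
  | zero => simp
  | add x y _ _ hx hy => rw [map_add]; exact add_mem hx hy
  | smul c x _ hx => rw [map_smul]; exact Submodule.smul_mem _ _ hx

theorem mode_omega_eq_L (k : ℤ) : A.mode A.omega k = A.L (-k - 2) := by
  rw [L_eq_mode]; congr 1; omega

theorem mode_omega_mem (k : ℤ) {u : V} (hu : u ∈ A.vacModule) :
    A.mode A.omega k u ∈ A.vacModule := by
  rw [mode_omega_eq_L]; exact A.L_mem_vacModule _ hu

variable {A} in
-- A lowering word of weight s ≥ 2 is sent to weight s - n > 0. The only other word is the vacuum,
-- which L_n kills for n ≥ -1 and raises to weight -n ≥ 2 for n ≤ -2. The absence of weight 1 is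
-- essential when n = 1.
theorem vacDual_L {h : A.IsCFTType} {n : ℤ} (hn : n ≤ 1) {u : V} (hu : u ∈ A.vacModule) :
    vacDual h (A.L n u) = 0 := by
  induction hu using Submodule.span_induction with
  | mem u hu =>
    obtain ⟨s, hs⟩ := hu
    have h0 := vacDual_L_zero h (A.L n u)
    rw [A.L_zero_L hs.L_zero, map_smul, smul_eq_mul, mul_eq_zero, Int.cast_eq_zero] at h0
    rcases hs.eq_vac_or with ⟨rfl, rfl⟩ | hs
    · rcases le_or_gt n (-2) with hn' | hn'
      · exact h0.resolve_left (by omega)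
      · rw [A.L_vac_of_le (by omega), map_zero]
    · exact h0.resolve_left (by omega)
  | zero => simp
  | add x y _ _ hx hy => rw [map_add, map_add, hx, hy, add_zero]
  | smul c x _ hx => rw [map_smul, map_smul, hx, smul_zero]

variable {A} in
theorem vacDual_mode_omega (h : A.IsCFTType) {k : ℤ} (hk : -3 ≤ k) {u : V} (hu : u ∈ A.vacModule) :
    vacDual h (A.mode A.omega k u) = 0 := by
  rw [mode_omega_eq_L]; exact vacDual_L (by omega) hu

/-! ### Correlation functions of the conformal vector -/

section Omega

variable {κ : Type*}

/-- The coefficient of `∏ z_a^(e a)` in the product of the fields `Y(ω, z_a)`, `a ∈ l`. -/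
noncomputable def omegaProd (l : List κ) (e : κ → ℤ) : Module.End ℂ V :=
  (l.map fun a => (A.mode A.omega (e a) : Module.End ℂ V)).prod

theorem omegaProd_cons (a : κ) (l : List κ) (e : κ → ℤ) (u : V) :
    A.omegaProd (a :: l) e u = A.mode A.omega (e a) (A.omegaProd l e u) := by
  simp [omegaProd]

theorem omegaProd_append (l l' : List κ) (e : κ → ℤ) (u : V) :
    A.omegaProd (l ++ l') e u = A.omegaProd l e (A.omegaProd l' e u) := by
  simp [omegaProd]

theorem omegaProd_nil (e : κ → ℤ) (u : V) : A.omegaProd [] e u = u := by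
  simp [omegaProd]

theorem omegaProd_congr {l : List κ} {e e' : κ → ℤ} (h : ∀ a ∈ l, e a = e' a) :
    A.omegaProd l e = A.omegaProd l e' := by
  rw [omegaProd, omegaProd]
  congr 1
  exact List.map_congr_left fun a ha => by rw [h a ha]

theorem omegaProd_map {ι : Type*} (c : ι → κ) (l : List ι) (e : κ → ℤ) :
    A.omegaProd (l.map c) e = A.omegaProd l (e ∘ c) := by
  rw [omegaProd, omegaProd, List.map_map]; rfl

theorem omegaProd_vac_mem (l : List κ) (e : κ → ℤ) : A.omegaProd l e A.vac ∈ A.vacModule := by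
  induction l with
  | nil => rw [omegaProd_nil]; exact A.vac_mem_vacModule
  | cons a l ih => rw [omegaProd_cons]; exact A.mode_omega_mem _ ih

/-- `∏_{a ≠ b} (z_a - z_b)^N`, where `N` is the order of the pole of `Y(ω, z₁)Y(ω, z₂)`. -/
noncomputable def disc (ι : Type*) [Fintype ι] [DecidableEq ι] : MvPolynomial ι ℂ :=
  ∏ p ∈ (Finset.univ : Finset ι).offDiag, (X p.1 - X p.2) ^ A.poleOrder A.omega A.omega

/-- Adjacent transpositions suffice, and the locality factor of each divides `disc`. The prefix
`pre` collects the fields passed on the way to the transposition. -/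
theorem act_disc_perm {E : Type*} [AddCommGroup E] [Module ℂ E] [Fintype κ] [DecidableEq κ]
    (φ : V →ₗ[ℂ] E) {l l' : List κ} (hl : l.Perm l') : ∀ pre : List κ, (pre ++ l).Nodup →
    act (A.disc κ) (fun e => φ (A.omegaProd (pre ++ l) e A.vac)) =
      act (A.disc κ) (fun e => φ (A.omegaProd (pre ++ l') e A.vac)) := by
  induction hl with
  | nil => intro _ _; rfl
  | cons a _ ih =>
    intro pre hpre
    have := ih (pre ++ [a]) (by simpa using hpre)
    simpa using this
  | trans h₁ _ ih₁ ih₂ =>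
    intro pre hpre
    rw [ih₁ pre hpre, ih₂ pre ((h₁.append_left pre).nodup_iff.1 hpre)]
  | swap a b l =>
    intro pre hpre
    have hba : b ≠ a := by
      rintro rfl
      simp [List.nodup_append] at hpre
    have hpb : ∀ x ∈ pre, x ≠ a ∧ x ≠ b := by
      intro x hx
      rw [List.nodup_append] at hpre
      exact ⟨hpre.2.2 x hx a (by simp), hpre.2.2 x hx b (by simp)⟩
    have hlb : ∀ x ∈ l, x ≠ a ∧ x ≠ b := by
      intro x hx
      rw [List.nodup_append] at hpre
      have := hpre.2.1
      simp only [List.nodup_cons, List.mem_cons, not_or] at this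
      exact ⟨fun h => this.2.1 (h ▸ hx), fun h => this.1.2 (h ▸ hx)⟩
    obtain ⟨q, hq⟩ : (X b - X a : MvPolynomial κ ℂ) ^ A.poleOrder A.omega A.omega ∣ A.disc κ :=
      Finset.dvd_prod_of_mem (a := (b, a)) (s := Finset.univ.offDiag)
        (f := fun p : κ × κ => ((X p.1 - X p.2) ^ A.poleOrder A.omega A.omega : MvPolynomial κ ℂ))
        (by simpa using hba)
    have := A.act_mode_comm A.omega A.omega hba (fun e => φ ∘ₗ A.omegaProd pre e)
      (fun e => A.omegaProd l e A.vac)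
      (fun e s t => by
        rw [A.omegaProd_congr fun x hx => ?_]
        simp [(hpb x hx).1, (hpb x hx).2])
      (fun e s t => by
        rw [A.omegaProd_congr fun x hx => ?_]
        simp [(hlb x hx).1, (hlb x hx).2]) le_rfl
    rw [hq, mul_comm, act_mul, act_mul]
    congr 1
    simpa only [omegaProd_append, omegaProd_cons, LinearMap.comp_apply] using this

variable {A} in
-- Order independence allows each variable z_a in turn to be put last, where creativity excludes
-- negative exponents, and first, where 𝟏' kills the exponents ≥ -3 of Y(ω, z_a). Multiplication by
-- `disc` raises exponents by at most its degree, so the support is finite.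
theorem exists_act_disc (h : A.IsCFTType) (ι : Type*) [Fintype ι] [DecidableEq ι] :
    ∃ Q : MvPolynomial ι ℂ, ∀ l : List ι, l.Nodup → (∀ a, a ∈ l) →
      act (A.disc ι) (fun e => vacDual h (A.omegaProd l e A.vac)) = act Q (const 1) := by
  have hperm : ∀ l l' : List ι, l.Nodup → l'.Nodup → (∀ a, a ∈ l) → (∀ a, a ∈ l') →
      act (A.disc ι) (fun e => vacDual h (A.omegaProd l e A.vac)) =
      act (A.disc ι) (fun e => vacDual h (A.omegaProd l' e A.vac)) := fun l l' hl hl' hm hm' =>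
    A.act_disc_perm (vacDual h) ((List.perm_ext_iff_of_nodup hl hl').2 fun a => by simp [hm, hm'])
      [] hl
  set D := act (A.disc ι) (fun e => vacDual h (A.omegaProd Finset.univ.toList e A.vac)) with hD
  have h₀ : ∀ e a, e a < 0 → D e = 0 := by
    intro e a ha
    have hnd : (Finset.univ.erase a).toList.Nodup := Finset.nodup_toList _
    rw [hD, hperm _ ((Finset.univ.erase a).toList ++ [a]) (Finset.nodup_toList _)
      (by rw [List.nodup_append]; simp [hnd]) (by simp) (by intro b; simp [em'])]
    refine act_eq_zero_of_shift _ fun s _ => ?_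
    rw [omegaProd_append, omegaProd_cons, omegaProd_nil, A.mode_vac_of_neg, map_zero, map_zero]
    omega
  have h₁ : ∀ e a, ((A.disc ι).totalDegree : ℤ) < e a → D e = 0 := by
    intro e a ha
    have hnd : (Finset.univ.erase a).toList.Nodup := Finset.nodup_toList _
    rw [hD, hperm _ (a :: (Finset.univ.erase a).toList) (Finset.nodup_toList _)
      (by rw [List.nodup_cons]; simp [hnd]) (by simp) (by intro b; simp [em])]
    refine act_eq_zero_of_shift _ fun s hs => ?_
    rw [omegaProd_cons]
    refine vacDual_mode_omega h ?_ (A.omegaProd_vac_mem _ _)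
    have := (monomial_le_degreeOf a hs).trans (degreeOf_le_totalDegree _ _)
    omega
  obtain ⟨Q, hQ⟩ := exists_act_const_eq D _ h₀ h₁
  exact ⟨Q, fun l hl hm => by
    rw [← hQ, hperm l Finset.univ.toList hl (Finset.nodup_toList _) hm fun a => by simp]⟩

end Omega

end VOA

/-! ### Correlation functions with clusters of conformal vectors -/

open FormalDist MvPolynomial

namespace FormalDist

/-- Extension of a distribution by the constant `1` in the variables outside the range of `c`. -/
noncomputable def extend {ι κ : Type*} (c : ι → κ) (f : (ι → ℤ) → ℂ) : (κ → ℤ) → ℂ :=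
  open Classical in fun e => if ∀ x ∉ Set.range c, e x = 0 then f (e ∘ c) else 0

theorem extend_const {ι κ : Type*} (c : ι → κ) : extend c (const 1) = const 1 := by
  funext e
  have : (e = 0) ↔ (∀ x ∉ Set.range c, e x = 0) ∧ e ∘ c = 0 := by
    constructor
    · rintro rfl; exact ⟨fun _ _ => rfl, rfl⟩
    · rintro ⟨h₁, h₂⟩
      funext x
      by_cases hx : x ∈ Set.range c
      · obtain ⟨a, rfl⟩ := hx; exact congrFun h₂ a
      · exact h₁ x hx
  simp only [extend, const]
  by_cases h₁ : ∀ x ∉ Set.range c, e x = 0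
  · rw [if_pos h₁]
    by_cases h₂ : e ∘ c = 0
    · rw [if_pos h₂, if_pos (this.2 ⟨h₁, h₂⟩)]
    · rw [if_neg h₂, if_neg fun h => h₂ (this.1 h).2]
  · rw [if_neg h₁, if_neg fun h => h₁ (this.1 h).1]

theorem act_rename_extend {ι κ : Type*} {c : ι → κ} (hc : Function.Injective c)
    (p : MvPolynomial ι ℂ) (f : (ι → ℤ) → ℂ) :
    act (rename c p) (extend c f) = extend c (act p f) := by
  induction p using MvPolynomial.induction_on' with
  | monomial s a =>
    funext e
    have h₁ : (∀ x ∉ Set.range c, e x - (s.mapDomain c x : ℤ) = 0) ↔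
        (∀ x ∉ Set.range c, e x = 0) := by
      refine forall₂_congr fun x hx => ?_
      rw [Finsupp.mapDomain_of_notMem_range _ _ hx]; simp
    have h₂ : (fun i => e i - (s.mapDomain c i : ℤ)) ∘ c = fun a => (e ∘ c) a - (s a : ℤ) := by
      funext a
      simp [Finsupp.mapDomain_apply hc]
    rw [rename_monomial, act_monomial]
    simp only [extend]
    by_cases h : ∀ x ∉ Set.range c, e x = 0
    · rw [if_pos (h₁.2 h), if_pos h, h₂, act_monomial]
    · rw [if_neg fun h' => h (h₁.1 h'), if_neg h, smul_zero]
  | add p q hp hq =>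
    rw [map_add, act_add, act_add, hp, hq]
    funext e
    simp only [extend, Pi.add_apply]
    split_ifs <;> simp

end FormalDist

/-- A factor of a correlation function: the field of `ω` at a point, or the field at a point of a
vector obtained by applying fields of `ω` to the vacuum. -/
inductive Insertion (κ : Type*) : Type _
  | point (a : κ) : Insertion κ
  | cluster (i : κ) (as : List κ) : Insertion κ

namespace Insertion

variable {κ : Type*}

/-- The variables of the fields of `ω` in an insertion. -/
def points : Insertion κ → List κ
  | point a => [a]
  | cluster _ as => as

/-- The variables of the centres of clusters. -/
def centres : Insertion κ → List κ
  | point _ => []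
  | cluster i _ => [i]

/-- The number of points in clusters. -/
def clustered : Insertion κ → ℕ
  | point _ => 0
  | cluster _ as => as.length

/-- The contribution of the centres of clusters to the position of a point. -/
noncomputable def shift (x : κ) : Insertion κ → MvPolynomial κ ℂ
  | point _ => 0
  | cluster i as => open Classical in if x ∈ as then X i else 0

/-- The positions of the points. -/
noncomputable def position (w : List (Insertion κ)) (x : κ) : MvPolynomial κ ℂ :=
  X x + (w.map (shift x)).sum

theorem translateVar_sum_shift [DecidableEq κ] {w : List (Insertion κ)} {x a i : κ}
    (ha : a ∉ w.flatMap centres) :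
    translateVar a i (w.map (shift x)).sum = (w.map (shift x)).sum := by
  rw [map_list_sum, List.map_map]
  congr 1
  refine List.map_congr_left fun y hy => ?_
  cases y with
  | point a => simp [shift]
  | cluster j as =>
    have : j ≠ a := by
      rintro rfl
      exact ha (List.mem_flatMap.2 ⟨_, hy, by simp [centres]⟩)
    simp only [Function.comp_apply, shift]
    split_ifs <;> simp [translateVar, this]

end Insertion

namespace VOA

open Insertion

variable {V : Type*} [AddCommGroup V] [Module ℂ V] (A : VOA V) {κ : Type*}

/-- The coefficient of `∏ z_x^(e x)` in the field of an insertion. -/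
noncomputable def insertionOp (e : κ → ℤ) : Insertion κ → Module.End ℂ V
  | point a => A.mode A.omega (e a)
  | cluster i as => A.mode (A.omegaProd as e A.vac) (e i)

/-- The coefficient of `∏ z_x^(e x)` in a product of insertions. -/
noncomputable def insertionProd (w : List (Insertion κ)) (e : κ → ℤ) : Module.End ℂ V :=
  (w.map (A.insertionOp e)).prod

theorem insertionProd_cons (y : Insertion κ) (w : List (Insertion κ)) (e : κ → ℤ) (u : V) :
    A.insertionProd (y :: w) e u = A.insertionOp e y (A.insertionProd w e u) := by
  simp [insertionProd]

theorem insertionProd_append (w w' : List (Insertion κ)) (e : κ → ℤ) (u : V) :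
    A.insertionProd (w ++ w') e u = A.insertionProd w e (A.insertionProd w' e u) := by
  simp [insertionProd]

theorem insertionProd_congr {w : List (Insertion κ)} {e e' : κ → ℤ}
    (h : ∀ a ∈ w.flatMap points, e a = e' a) (h' : ∀ i ∈ w.flatMap centres, e i = e' i) :
    A.insertionProd w e = A.insertionProd w e' := by
  rw [insertionProd, insertionProd]
  congr 1
  refine List.map_congr_left fun y hy => ?_
  cases y with
  | point a =>
    simp only [insertionOp]
    rw [h a (List.mem_flatMap.2 ⟨_, hy, by simp [points]⟩)]
  | cluster i as =>
    simp only [insertionOp]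
    rw [h' i (List.mem_flatMap.2 ⟨_, hy, by simp [centres]⟩),
      A.omegaProd_congr (l := as) fun a ha => h a (List.mem_flatMap.2 ⟨_, hy, ha⟩)]

/-- Empty clusters do not contribute. -/
theorem insertionProd_of_clustered_eq_zero {w : List (Insertion κ)}
    (hw : ∀ y ∈ w, y.clustered = 0) (e : κ → ℤ) (u : V) :
    A.insertionProd w e u = open Classical in
      if ∀ i ∈ w.flatMap centres, e i = 0 then A.omegaProd (w.flatMap points) e u else 0 := by
  induction w with
  | nil => simp [insertionProd, omegaProd]
  | cons y w ih =>
    rw [insertionProd_cons, ih fun y hy => hw y (List.mem_cons_of_mem _ hy)]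
    cases y with
    | point a =>
      simp only [List.flatMap_cons, centres, points, List.nil_append, List.singleton_append,
        omegaProd_cons, insertionOp]
      split_ifs
      · rfl
      · rw [map_zero]
    | cluster i as =>
      obtain rfl : as = [] := List.length_eq_zero_iff.1 (hw (cluster i as) (by simp))
      simp only [List.flatMap_cons, centres, points, List.nil_append, List.singleton_append,
        insertionOp, omegaProd_nil, mode_vac, List.forall_mem_cons, ite_and]

/-- The points of `w` are the variables in the range of `c`, and the centres of its clusters are the
other variables, each of them occurring once. -/
structure IsComplete {ι : Type*} (c : ι → κ) (w : List (Insertion κ)) : Prop where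
  nodup_points : (w.flatMap points).Nodup
  nodup_centres : (w.flatMap centres).Nodup
  mem_points : ∀ x, x ∈ w.flatMap points ↔ x ∈ Set.range c
  mem_centres : ∀ x, x ∈ w.flatMap centres ↔ x ∉ Set.range c

variable {A}

/-- The start of the induction: the centres carry identity operators, so the correlation function is
one of fields of ω alone, extended by 1, and every point sits at its own variable. -/
theorem act_insertionProd_of_clustered_eq_zero (h : A.IsCFTType) {ι : Type*} [Fintype ι]
    [DecidableEq ι] {c : ι → κ} (hc : Function.Injective c) {Q : MvPolynomial ι ℂ}
    (hQ : ∀ l : List ι, l.Nodup → (∀ a, a ∈ l) →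
      act (A.disc ι) (fun e => vacDual h (A.omegaProd l e A.vac)) = act Q (const 1))
    {w : List (Insertion κ)} (hw : IsComplete c w) (hw₀ : ∀ y ∈ w, y.clustered = 0) :
    act (aeval (fun a => position w (c a)) (A.disc ι))
      (fun e => vacDual h (A.insertionProd w e A.vac)) =
    act (aeval (fun a => position w (c a)) Q) (const 1) := by
  obtain ⟨l, hl⟩ : ∃ l : List ι, l.map c = w.flatMap points := by
    rw [← Set.mem_range, Set.range_list_map]
    exact fun x hx => (hw.mem_points x).1 hx
  have hpos : ∀ x, position w x = X x := by
    intro x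
    rw [position, List.sum_eq_zero, add_zero]
    intro p hp
    rw [List.mem_map] at hp
    obtain ⟨y, hy, rfl⟩ := hp
    cases y with
    | point a => rfl
    | cluster i as =>
      obtain rfl : as = [] := List.length_eq_zero_iff.1 (hw₀ _ hy)
      simp [shift]
  have hren : ∀ p : MvPolynomial ι ℂ, aeval (fun a => position w (c a)) p = rename c p := by
    intro p
    simp only [hpos]
    exact AlgHom.congr_fun (algHom_ext fun a => by simp) p
  have hext : (fun e => vacDual h (A.insertionProd w e A.vac)) =
      extend c (fun e => vacDual h (A.omegaProd l e A.vac)) := by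
    funext e
    rw [A.insertionProd_of_clustered_eq_zero hw₀, ← hl, omegaProd_map]
    simp only [extend]
    by_cases he : ∀ x ∉ Set.range c, e x = 0
    · rw [if_pos he, if_pos fun i hi => he i ((hw.mem_centres i).1 hi)]
    · rw [if_neg he, if_neg fun h => he fun i hi => h i ((hw.mem_centres i).2 hi), map_zero]
  have hlc : ∀ a, a ∈ l := by
    intro a
    have := (hw.mem_points (c a)).2 ⟨a, rfl⟩
    rwa [← hl, List.mem_map_of_injective hc] at this
  have hln : l.Nodup := (hl ▸ hw.nodup_points : (l.map c).Nodup).of_map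
  rw [hren, hren, hext, act_rename_extend hc, hQ l hln hlc, ← act_rename_extend hc, extend_const]

/-- The iterate formula for ω and the rest of the cluster. Completeness ensures that the variables a
and i occur nowhere else, so all other factors are constant along the direction a - i. -/
theorem isResidue_insertionProd [DecidableEq κ] (h : A.IsCFTType) {ι : Type*} {c : ι → κ}
    {w₁ w₂ : List (Insertion κ)} {i a : κ} {as : List κ}
    (hw : IsComplete c (w₁ ++ cluster i (a :: as) :: w₂)) :
    IsResidue a i (fun e => vacDual h (A.insertionProd (w₁ ++ point a :: cluster i as :: w₂) e A.vac))
      (fun e => vacDual h (A.insertionProd (w₁ ++ cluster i as :: point a :: w₂) e A.vac))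
      (fun e => vacDual h (A.insertionProd (w₁ ++ cluster i (a :: as) :: w₂) e A.vac)) := by
  have hp := hw.nodup_points
  have hq := hw.nodup_centres
  have hi := (hw.mem_centres i).1 (by simp [centres])
  have hpi : ∀ x, x ∈ (w₁ ++ cluster i (a :: as) :: w₂).flatMap points → x ≠ i := by
    rintro x hx rfl; exact hi ((hw.mem_points _).1 hx)
  have hca : ∀ x, x ∈ (w₁ ++ cluster i (a :: as) :: w₂).flatMap centres → x ≠ a := by
    rintro x hx rfl
    exact (hw.mem_centres _).1 hx ((hw.mem_points _).1 (by simp [points]))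
  simp only [List.flatMap_append, List.flatMap_cons, points, centres, List.nodup_append,
    List.mem_append, List.mem_cons, List.nodup_cons] at hp hq hpi hca
  have hai : a ≠ i := hpi a (by simp)
  have hinv : ∀ (e : κ → ℤ) (n : ℤ) (x : κ), x ≠ a → x ≠ i →
      (e + n • (Pi.single a 1 - Pi.single i 1) : κ → ℤ) x = e x := by
    intro e n x h₁ h₂; simp [h₁, h₂]
  have hw₁ : ∀ e (n : ℤ), A.insertionProd w₁ (e + n • (Pi.single a 1 - Pi.single i 1)) =
      A.insertionProd w₁ e := by
    intro e n
    refine A.insertionProd_congr (fun x hx => hinv e n x ?_ (hpi x (by simp [hx])))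
      (fun x hx => hinv e n x (hca x (by simp [hx])) ?_)
    · exact hp.2.2 x hx a (by simp)
    · exact hq.2.2 x hx i (by simp)
  have hw₂ : ∀ e (n : ℤ), A.insertionProd w₂ (e + n • (Pi.single a 1 - Pi.single i 1)) =
      A.insertionProd w₂ e := by
    intro e n
    refine A.insertionProd_congr (fun x hx => hinv e n x ?_ (hpi x (by simp [hx])))
      (fun x hx => hinv e n x (hca x (by simp [hx])) ?_)
    · exact (hp.2.1.2.2 a (by simp) x hx).symm
    · exact (hq.2.1.2.2 i (by simp) x hx).symm
  have has : ∀ e (n : ℤ), A.omegaProd as (e + n • (Pi.single a 1 - Pi.single i 1)) =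
      A.omegaProd as e := by
    intro e n
    refine A.omegaProd_congr (fun x hx => hinv e n x ?_ (hpi x (by simp [hx])))
    rintro rfl
    exact hp.2.1.1.1 hx
  have := A.isResidue_mode_mode A.omega hai (fun e => vacDual h ∘ₗ A.insertionProd w₁ e)
    (fun e => A.omegaProd as e A.vac) (fun e => A.insertionProd w₂ e A.vac)
    (fun e n => by rw [has]) (fun e n => by rw [hw₁]) (fun e n => by rw [hw₂])
  simpa only [insertionProd_append, insertionProd_cons, LinearMap.comp_apply, insertionOp,
    omegaProd_cons] using this

/-- A correlation function of insertions is the rational function `Q / disc` evaluated at the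
positions of the points, after the denominator has been cleared. -/
theorem act_insertionProd [DecidableEq κ] (h : A.IsCFTType) {ι : Type*} [Fintype ι]
    [DecidableEq ι] {c : ι → κ} (hc : Function.Injective c) {Q : MvPolynomial ι ℂ}
    (hQ : ∀ l : List ι, l.Nodup → (∀ a, a ∈ l) →
      act (A.disc ι) (fun e => vacDual h (A.omegaProd l e A.vac)) = act Q (const 1))
    (n : ℕ) : ∀ {w : List (Insertion κ)}, IsComplete c w → (w.map clustered).sum = n →
    act (aeval (fun a => position w (c a)) (A.disc ι))
      (fun e => vacDual h (A.insertionProd w e A.vac)) =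
    act (aeval (fun a => position w (c a)) Q) (const 1) := by
  induction n with
  | zero =>
    intro w hw hn
    refine act_insertionProd_of_clustered_eq_zero h hc hQ hw fun y hy => ?_
    exact List.sum_eq_zero_iff.1 hn _ (List.mem_map_of_mem hy)
  | succ n ih =>
    intro w hw hn
    obtain ⟨y, hy, hy₀⟩ : ∃ y ∈ w, y.clustered ≠ 0 := by
      by_contra! hcon
      rw [List.sum_eq_zero] at hn
      · omega
      · intro x hx
        rw [List.mem_map] at hx
        obtain ⟨y, hy, rfl⟩ := hx
        exact hcon y hy
    obtain ⟨w₁, w₂, rfl⟩ := List.append_of_mem hy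
    obtain ⟨i, a, as, rfl⟩ : ∃ i a as, y = cluster i (a :: as) := by
      rcases y with a | ⟨i, _ | ⟨a, as⟩⟩
      · simp [clustered] at hy₀
      · simp [clustered] at hy₀
      · exact ⟨i, a, as, rfl⟩
    have hres := isResidue_insertionProd h hw
    have hp := hw.nodup_points
    have hca : ∀ x, x ∈ (w₁ ++ cluster i (a :: as) :: w₂).flatMap centres → x ≠ a := by
      rintro x hx rfl
      exact (hw.mem_centres _).1 hx ((hw.mem_points _).1 (by simp [points]))
    have hai : a ≠ i := (hca i (by simp [centres])).symm
    have hcomp : ∀ w' : List (Insertion κ),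
        (w'.flatMap points).Perm ((w₁ ++ cluster i (a :: as) :: w₂).flatMap points) →
        (w'.flatMap centres).Perm ((w₁ ++ cluster i (a :: as) :: w₂).flatMap centres) →
        IsComplete c w' := fun w' h₁ h₂ =>
      ⟨h₁.nodup_iff.2 hw.nodup_points, h₂.nodup_iff.2 hw.nodup_centres,
        fun x => h₁.mem_iff.trans (hw.mem_points x), fun x => h₂.mem_iff.trans (hw.mem_centres x)⟩
    -- The leading point of the cluster is released to its left and to its right. Both words have
    -- one clustered point fewer and the same positions, hence the same cleared form.
    have h₁ := ih (hcomp (w₁ ++ point a :: cluster i as :: w₂)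
      (by simp [points]) (by simp [centres])) (by simp [clustered] at hn ⊢; omega)
    have h₂ := ih (hcomp (w₁ ++ cluster i as :: point a :: w₂)
      (by
        simp only [List.flatMap_append, List.flatMap_cons, points, List.cons_append]
        exact List.Perm.append_left _ List.perm_middle)
      (by simp [centres])) (by simp [clustered] at hn ⊢; omega)
    -- Putting the point back into the cluster moves it from z_a to z_a + z_i and leaves the other
    -- points in place.
    have hpos₁ : ∀ x, translateVar a i (position (w₁ ++ point a :: cluster i as :: w₂) x) =
        position (w₁ ++ cluster i (a :: as) :: w₂) x := by
      intro x
      have hs₁ : translateVar a i (w₁.map (shift x)).sum = (w₁.map (shift x)).sum :=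
        translateVar_sum_shift fun h => hca a (by simp [h]) rfl
      have hs₂ : translateVar a i (w₂.map (shift x)).sum = (w₂.map (shift x)).sum :=
        translateVar_sum_shift fun h => hca a (by simp [h]) rfl
      have hXi : translateVar a i (X i) = X i := by simp [translateVar, hai.symm]
      simp only [position, List.map_append, List.map_cons, List.sum_append, List.sum_cons, map_add,
        hs₁, hs₂, shift, zero_add]
      rcases eq_or_ne x a with rfl | hx
      · have has : x ∉ as := by
          simp only [List.flatMap_append, List.flatMap_cons, points, List.nodup_append,
            List.nodup_cons] at hp
          exact hp.2.1.1.1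
        rw [if_neg has, if_pos (by simp), map_zero]
        simp [translateVar]; ring
      · have hXx : translateVar a i (X x) = X x := by simp [translateVar, hx]
        simp only [List.mem_cons, hx, false_or, hXx]
        split_ifs <;> simp [hXi]
    have hpos₂ : ∀ x, position (w₁ ++ cluster i as :: point a :: w₂) x =
        position (w₁ ++ point a :: cluster i as :: w₂) x := by
      intro x; simp [position, shift]
    simp only [hpos₂] at h₂
    have hae : ∀ p : MvPolynomial ι ℂ,
        translateVar a i (aeval (fun b => position (w₁ ++ point a :: cluster i as :: w₂) (c b)) p) =
        aeval (fun b => position (w₁ ++ cluster i (a :: as) :: w₂) (c b)) p := by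
      intro p
      rw [← AlgHom.comp_apply, comp_aeval]
      simp only [hpos₁]
    have := hres.act_eq_act_const hai h₁ h₂
    rwa [hae, hae] at this

end VOA

open FormalDist MvPolynomial

/-! ### Expansions -/

namespace ExpansionField

variable {n : ℕ}

theorem coefficient_injective :
    Function.Injective (coefficient : ExpansionField n → (Fin n → ℤ) → ℂ) := by
  intro s t h
  ext x
  exact congrFun h x

theorem coefficient_add (s t : ExpansionField n) :
    coefficient (s + t) = coefficient s + coefficient t := rfl

theorem coefficient_var_mul (i : Fin n) (s : ExpansionField n) :
    coefficient (var i * s) = act (X i) (coefficient s) := by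
  funext k
  rw [act_X, coefficient, var, HahnSeries.coeff_single_mul, one_mul]
  rfl

theorem coefficient_aeval_mul (p : MvPolynomial (Fin n) ℂ) : ∀ s : ExpansionField n,
    coefficient (aeval var p * s) = act p (coefficient s) := by
  induction p using MvPolynomial.induction_on with
  | C c =>
    intro s
    rw [aeval_C, act_C]
    funext k
    rw [← Algebra.smul_def]
    rfl
  | add p q hp hq => intro s; rw [map_add, add_mul, coefficient_add, hp, hq, act_add]
  | mul_X p i hp => intro s; rw [map_mul, aeval_X, mul_assoc, hp, coefficient_var_mul, act_mul]

theorem coefficient_one : coefficient (1 : ExpansionField n) = const 1 := by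
  funext k
  rw [coefficient, const, HahnSeries.coeff_one]
  by_cases h : k = 0
  · rw [if_pos h, if_pos (by rw [h]; rfl)]
  · exact (if_neg fun h' => h h').trans (if_neg h).symm

theorem coefficient_aeval (p : MvPolynomial (Fin n) ℂ) :
    coefficient (aeval var p) = act p (const 1) := by
  rw [← mul_one (aeval var p), coefficient_aeval_mul, coefficient_one]

theorem aeval_var_injective :
    Function.Injective (aeval var : MvPolynomial (Fin n) ℂ →ₐ[ℂ] ExpansionField n) := by
  intro p q h
  apply act_const_injective
  simp only [← coefficient_aeval, h]

/-- `f(z₁, …, zₙ)` is a formal Laurent series in `zₙ` whose coefficients are formal Laurent series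
in `zₙ₋₁`, and so on. -/
def IsIteratedLaurent (f : (Fin n → ℤ) → ℂ) : Prop :=
  ∀ (i : Fin n) (e : Fin n → ℤ), ∃ B : ℤ, ∀ e' : Fin n → ℤ, (∀ j, i < j → e' j = e j) →
    e' i < B → f e' = 0

/-- The colexicographic minimum is found from the last coordinate downwards: k counts the
coordinates already minimised, and the next one is bounded below among elements that agree with the
current candidate in the later coordinates. -/
theorem IsIteratedLaurent.exists_min {f : (Fin n → ℤ) → ℂ} (hf : IsIteratedLaurent f)
    {T : Set (Fin n → ℤ)} (hT : T.Nonempty) (hTf : ∀ x ∈ T, f x ≠ 0) (k : ℕ) :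
    ∃ m ∈ T, ∀ x ∈ T, ∀ i : Fin n, n ≤ i + k → (∀ j, i < j → x j = m j) → m i ≤ x i := by
  induction k with
  | zero =>
    obtain ⟨m, hm⟩ := hT
    exact ⟨m, hm, fun x _ i hi => absurd i.2 (by omega)⟩
  | succ k ih =>
    obtain ⟨m, hm, hmin⟩ := ih
    by_cases hk : k + 1 ≤ n
    · let i₀ : Fin n := ⟨n - (k + 1), by omega⟩
      obtain ⟨B, hB⟩ := hf i₀ m
      obtain ⟨b, ⟨m', ⟨hm'T, hm'⟩, rfl⟩, hleast⟩ := Int.exists_least_of_bdd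
        (P := fun z => ∃ x, (x ∈ T ∧ ∀ j, i₀ < j → x j = m j) ∧ x i₀ = z)
        ⟨B, by
          rintro _ ⟨x, ⟨hx, hxm⟩, rfl⟩
          by_contra! hlt
          exact hTf x hx (hB x hxm hlt)⟩
        ⟨m i₀, m, ⟨hm, fun _ _ => rfl⟩, rfl⟩
      refine ⟨m', hm'T, fun x hx i hi hxi => ?_⟩
      rcases eq_or_ne i i₀ with rfl | hne
      · exact hleast _ ⟨x, ⟨hx, fun j hj => (hxi j hj).trans (hm' j hj)⟩, rfl⟩
      · have hi₀ : n - (k + 1) ≠ i := fun h => hne (Fin.ext h.symm)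
        have hlt : i₀ < i := by
          rw [Fin.lt_def]
          change n - (k + 1) < i
          omega
        rw [hm' i hlt]
        exact hmin x hx i (by omega) fun j hj => (hxi j hj).trans (hm' j (hlt.trans hj))
    · exact ⟨m, hm, fun x hx i hi => hmin x hx i (by omega)⟩

theorem IsIteratedLaurent.exists_coefficient_eq {f : (Fin n → ℤ) → ℂ}
    (hf : IsIteratedLaurent f) : ∃ s : ExpansionField n, coefficient s = f := by
  have hwf : (Function.support fun x : Exponent n => f x).IsPWO := by
    rw [Set.isPWO_iff_isWF]
    refine Set.wellFoundedOn_iff.2 (WellFounded.wellFounded_iff_has_min.2 fun S hS => ?_)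
    by_cases hne : ∃ x ∈ S, f x ≠ 0
    · obtain ⟨m, ⟨hmS, hm⟩, hmin⟩ := hf.exists_min (T := {x | x ∈ S ∧ f x ≠ 0}) hne
        (fun x hx => hx.2) n
      refine ⟨m, hmS, fun x hxS ⟨hlt, hx, _⟩ => ?_⟩
      obtain ⟨i, hi, hlt⟩ := (Exponent.lt_iff x m).1 hlt
      exact absurd hlt (not_lt.2 (hmin x ⟨hxS, hx⟩ i (by omega) hi))
    · push Not at hne
      obtain ⟨m, hm⟩ := hS
      exact ⟨m, hm, fun x _ hx => hx.2.2 (hne m hm)⟩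
  exact ⟨⟨fun x : Exponent n => f x, hwf⟩, rfl⟩

end ExpansionField

/-! ### Values and expansions of rational functions -/

namespace MvRat

variable {n : ℕ} {F : Type*} [Field F] [Algebra ℂ F]

/-- The value of a fraction at a point where the denominator does not vanish. -/
theorem eval_div (p q : MvPolynomial (Fin n) ℂ) {u : Fin n → F} (hq : aeval u q ≠ 0) :
    eval (algebraMap _ (MvRat n) p / algebraMap _ (MvRat n) q) u = aeval u p / aeval u q := by
  set f : MvRat n := algebraMap _ (MvRat n) p / algebraMap _ (MvRat n) q with hf
  set a := IsFractionRing.num (MvPolynomial (Fin n) ℂ) f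
  set d := (IsFractionRing.den (MvPolynomial (Fin n) ℂ) f : MvPolynomial (Fin n) ℂ) with hd
  have hinj := IsFractionRing.injective (MvPolynomial (Fin n) ℂ) (MvRat n)
  have hq₀ : q ≠ 0 := by rintro rfl; simp at hq
  have hd₀ : d ≠ 0 := nonZeroDivisors.ne_zero (IsFractionRing.den _ f).2
  have hq₁ : algebraMap _ (MvRat n) q ≠ 0 := by
    rwa [Ne, map_eq_zero_iff _ hinj]
  have hd₁ : algebraMap _ (MvRat n) d ≠ 0 := by
    rwa [Ne, map_eq_zero_iff _ hinj]
  have hmul : a * q = p * d := by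
    apply hinj
    rw [map_mul, map_mul, ← div_eq_div_iff hd₁ hq₁]
    exact IsFractionRing.mk'_num_den' _ f
  -- `eval` uses the reduced fraction. Its denominator divides q, so it does not vanish at u either.
  have hdvd : d ∣ q := (IsFractionRing.num_den_reduced _ f).symm.dvd_of_dvd_mul_left
    (hmul ▸ dvd_mul_left d p)
  have hdu : aeval u d ≠ 0 := by
    obtain ⟨r, hr⟩ := hdvd
    intro h0
    rw [hr, map_mul, h0, zero_mul] at hq
    exact hq rfl
  rw [eval, div_eq_div_iff hdu hq, ← map_mul, ← map_mul, hmul]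

theorem expand_injective : Function.Injective (expand : MvRat n → ExpansionField n) := by
  intro f g h
  have hden : ∀ f : MvRat n, aeval ExpansionField.var
      (IsFractionRing.den (MvPolynomial (Fin n) ℂ) f : MvPolynomial (Fin n) ℂ) ≠ 0 := by
    intro f h0
    exact nonZeroDivisors.ne_zero (IsFractionRing.den _ f).2
      (ExpansionField.aeval_var_injective (h0.trans (map_zero _).symm))
  have h := (div_eq_div_iff (hden f) (hden g)).1 h
  rw [← map_mul, ← map_mul] at h
  have h := ExpansionField.aeval_var_injective h
  exact (IsFractionRing.num_mul_den_eq_num_mul_den_iff_eq (A := MvPolynomial (Fin n) ℂ)).1 h.symm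

end MvRat

open FormalDist MvPolynomial

theorem List.prod_ofFn_apply {V : Type*} [AddCommGroup V] [Module ℂ V] {n : ℕ}
    (T : Fin n → Module.End ℂ V) (i : Fin n) (u : V) :
    (List.ofFn T).prod u =
      ((List.ofFn T).take i).prod (T i (((List.ofFn T).drop (i + 1)).prod u)) := by
  conv_lhs => rw [← List.prod_take_mul_prod_drop (List.ofFn T) i]
  rw [List.drop_eq_getElem_cons (by simp), List.prod_cons, List.getElem_ofFn]
  rfl

theorem List.drop_ofFn_congr {α : Type*} {n : ℕ} {T T' : Fin n → α} (i : Fin n)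
    (h : ∀ j, i < j → T j = T' j) :
    (List.ofFn T).drop (i + 1) = (List.ofFn T').drop (i + 1) := by
  apply List.ext_getElem (by simp)
  intro k hk hk'
  simp only [List.getElem_drop, List.getElem_ofFn]
  exact h _ (by rw [Fin.lt_def]; simp only; omega)

/-! ### The rational correlation functions and their expansions -/

namespace VOA

open Insertion ExpansionField

variable {V : Type*} [AddCommGroup V] [Module ℂ V] {A : VOA V}

theorem aeval_disc_ne_zero {ι F : Type*} [Fintype ι] [DecidableEq ι] [Field F] [Algebra ℂ F]
    {u : ι → F} (hu : Function.Injective u) : aeval u (A.disc ι) ≠ 0 := by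
  rw [disc, map_prod, Finset.prod_ne_zero_iff]
  intro p hp
  rw [map_pow, map_sub, aeval_X, aeval_X]
  exact pow_ne_zero _ (sub_ne_zero.2 fun h => (Finset.mem_offDiag.1 hp).2.2 (hu h))

theorem rename_disc {ι : Type*} [Fintype ι] [DecidableEq ι] (σ : Equiv.Perm ι) :
    rename σ (A.disc ι) = A.disc ι := by
  rw [disc, map_prod]
  refine Finset.prod_equiv (σ.prodCongr σ) (fun p => ?_) fun p _ => ?_
  · simp [Finset.mem_offDiag]
  · simp

/-- The numerator of the correlation function of `ω` over the denominator `disc`. -/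
noncomputable def omegaNumerator (h : A.IsCFTType) (m : ℕ) : MvPolynomial (Fin m) ℂ :=
  (exists_act_disc h (Fin m)).choose

theorem act_disc_omegaProd (h : A.IsCFTType) (m : ℕ) (l : List (Fin m)) (hl : l.Nodup)
    (hm : ∀ a, a ∈ l) : act (A.disc (Fin m)) (fun e => vacDual h (A.omegaProd l e A.vac)) =
      act (omegaNumerator h m) (const 1) :=
  (exists_act_disc h (Fin m)).choose_spec l hl hm

/-- The genus zero correlation function of `m` copies of `ω`, as a rational function. -/
noncomputable def omegaCorrelator (h : A.IsCFTType) (m : ℕ) : MvRat m :=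
  algebraMap _ (MvRat m) (omegaNumerator h m) / algebraMap _ (MvRat m) (A.disc (Fin m))

/-- Renaming the variables amounts to multiplying the fields in another order, which has the same
cleared form. `disc` itself is invariant because it runs over ordered pairs. -/
theorem rename_omegaNumerator (h : A.IsCFTType) (m : ℕ) (σ : Equiv.Perm (Fin m)) :
    rename σ (omegaNumerator h m) = omegaNumerator h m := by
  apply act_const_injective
  have hl : (List.finRange m).Nodup := List.nodup_finRange m
  have hex : extend σ (fun e => vacDual h (A.omegaProd (List.finRange m) e A.vac)) =
      fun e => vacDual h (A.omegaProd ((List.finRange m).map σ) e A.vac) := by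
    funext e
    rw [extend, omegaProd_map]
    exact if_pos fun x hx => absurd (σ.surjective x) hx
  simp only
  conv_lhs => rw [← extend_const σ]
  rw [act_rename_extend σ.injective, ← act_disc_omegaProd h m _ hl (List.mem_finRange),
    ← act_rename_extend σ.injective, rename_disc, hex]
  exact (act_disc_omegaProd h m _ (hl.map σ.injective)
    fun a => List.mem_map.2 ⟨σ.symm a, List.mem_finRange _, by simp⟩).trans
      (act_disc_omegaProd h m _ hl List.mem_finRange).symm

theorem omegaCorrelator_isSymmetric (h : A.IsCFTType) (m : ℕ) :
    (omegaCorrelator h m).IsSymmetric := by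
  intro σ
  have hinj := IsFractionRing.injective (MvPolynomial (Fin m) ℂ) (MvRat m)
  have haev : ∀ p : MvPolynomial (Fin m) ℂ,
      aeval (fun i => (MvRat.var (σ i) : MvRat m)) p = algebraMap _ (MvRat m) (rename σ p) := by
    intro p
    have : aeval (fun i => (MvRat.var (σ i) : MvRat m)) =
        (IsScalarTower.toAlgHom ℂ (MvPolynomial (Fin m) ℂ) (MvRat m)).comp (rename σ) :=
      algHom_ext fun i => by simp [MvRat.var]
    rw [this]; rfl
  have hu : Function.Injective fun i => (MvRat.var (σ i) : MvRat m) := fun i j hij =>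
    σ.injective (X_injective (hinj hij))
  rw [omegaCorrelator, MvRat.eval_div _ _ (aeval_disc_ne_zero hu), haev, haev, rename_disc,
    rename_omegaNumerator]

/-- A distribution which becomes `Q` after multiplication by `disc` is the expansion of
`Q / disc`. -/
theorem eq_coefficient_eval (h : A.IsCFTType) {N M : ℕ} {f : (Fin M → ℤ) → ℂ}
    (hf : IsIteratedLaurent f) (u : Fin N → MvPolynomial (Fin M) ℂ) (hu : Function.Injective u)
    (hfu : act (aeval u (A.disc (Fin N))) f = act (aeval u (omegaNumerator h N)) (const 1)) :
    f = coefficient ((omegaCorrelator h N).eval fun a => aeval ExpansionField.var (u a)) := by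
  obtain ⟨s, rfl⟩ := hf.exists_coefficient_eq
  have hae : ∀ p : MvPolynomial (Fin N) ℂ, aeval ExpansionField.var (aeval u p) =
      aeval (fun a => aeval (ExpansionField.var (n := M)) (u a)) p := by
    intro p
    rw [← AlgHom.comp_apply, comp_aeval]
  rw [← coefficient_aeval_mul, ← coefficient_aeval] at hfu
  have hfu := coefficient_injective hfu
  rw [hae, hae] at hfu
  have hne : aeval (fun a => aeval (ExpansionField.var (n := M)) (u a)) (A.disc (Fin N)) ≠ 0 :=
    aeval_disc_ne_zero (aeval_var_injective.comp hu)
  rw [omegaCorrelator, MvRat.eval_div _ _ hne, ← hfu, mul_div_cancel_left₀ _ hne]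

theorem npt_omega_eq (h : A.IsCFTType) (m : ℕ) (k : Fin m → ℤ) :
    npt h (fun _ => A.omega) k = vacDual h (A.omegaProd (List.finRange m) k A.vac) := by
  rw [npt, omegaProd, List.ofFn_eq_map]; rfl

/-- The later exponents determine the vector to which the i-th field is applied, and lower
truncation on that vector gives the bound. -/
theorem isIteratedLaurent_npt_omega (h : A.IsCFTType) (m : ℕ) :
    IsIteratedLaurent fun k : Fin m → ℤ => npt h (fun _ => A.omega) k := by
  intro i e
  obtain ⟨B, hB⟩ := A.exists_mode_eq_zero A.omega
    (((List.ofFn fun j => (A.mode A.omega (e j) : Module.End ℂ V)).drop (i + 1)).prod A.vac)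
  refine ⟨B, fun e' he' hlt => ?_⟩
  change vacDual h ((List.ofFn fun j => (A.mode A.omega (e' j) : Module.End ℂ V)).prod A.vac) = 0
  rw [List.prod_ofFn_apply _ i, List.drop_ofFn_congr i fun j hj => by rw [he' j hj], hB _ hlt,
    map_zero, map_zero]

theorem expand_omegaCorrelator (h : A.IsCFTType) (m : ℕ) :
    coefficient (omegaCorrelator h m).expand = fun k => npt h (fun _ => A.omega) k := by
  have := eq_coefficient_eval h (isIteratedLaurent_npt_omega h m) X (X_injective) (by
    simp only [npt_omega_eq, aeval_X_left_apply]
    exact act_disc_omegaProd h m _ (List.nodup_finRange m) List.mem_finRange)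
  rw [this]
  simp only [aeval_X]
  rfl

/-! ### Correlation functions of descendants -/

section Descendants

variable {n : ℕ} (r : Fin n → ℕ)

/-- The variable `x_{ij}`. -/
def pointVar (i : Fin n) (j : Fin (r i)) : Fin (n + ∑ i, r i) :=
  Fin.natAdd n (finSigmaFinEquiv ⟨i, j⟩)

/-- The insertions of descendants at `w₁, …, wₙ`. -/
def descendantWord : List (Insertion (Fin (n + ∑ i, r i))) :=
  List.ofFn fun i => cluster (Fin.castAdd _ i) (List.ofFn (pointVar r i))

theorem pointVar_injective {i i' : Fin n} {j : Fin (r i)} {j' : Fin (r i')}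
    (h : pointVar r i j = pointVar r i' j') :
    (⟨i, j⟩ : (i : Fin n) × Fin (r i)) = ⟨i', j'⟩ :=
  finSigmaFinEquiv.injective (Fin.natAdd_injective _ _ h)

theorem descendantWord_centres :
    (descendantWord r).flatMap centres = (List.finRange n).map (Fin.castAdd _) := by
  rw [descendantWord, List.ofFn_eq_map, List.flatMap_map]
  exact List.map_eq_flatMap.symm

theorem descendantWord_points :
    (descendantWord r).flatMap points =
      (List.finRange n).flatMap fun i => List.ofFn (pointVar r i) := by
  rw [descendantWord, List.ofFn_eq_map, List.flatMap_map]
  rfl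

theorem isComplete_descendantWord :
    IsComplete (Fin.natAdd n (m := ∑ i, r i)) (descendantWord r) where
  nodup_points := by
    rw [descendantWord_points, List.nodup_flatMap]
    refine ⟨fun i _ => ?_, ?_⟩
    · rw [List.nodup_ofFn]
      intro j j' h
      simpa using pointVar_injective r h
    · refine (List.nodup_finRange n).pairwise_of_forall_ne fun i _ i' _ hne => ?_
      intro x hx hx'
      rw [List.mem_ofFn] at hx hx'
      obtain ⟨j, rfl⟩ := hx
      obtain ⟨j', h⟩ := hx'
      exact hne (congrArg Sigma.fst (pointVar_injective r h)).symm
  nodup_centres := by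
    rw [descendantWord_centres]
    exact (List.nodup_finRange n).map (Fin.castAdd_injective _ _)
  mem_points x := by
    simp only [descendantWord_points, List.mem_flatMap, List.mem_finRange, true_and, List.mem_ofFn]
    constructor
    · rintro ⟨i, j, rfl⟩
      exact ⟨_, rfl⟩
    · rintro ⟨a, rfl⟩
      exact ⟨(finSigmaFinEquiv.symm a).1, (finSigmaFinEquiv.symm a).2, by simp [pointVar]⟩
  mem_centres x := by
    simp only [descendantWord_centres, List.mem_map, List.mem_finRange, true_and, Set.mem_range,
      not_exists]
    induction x using Fin.addCases with
    | left i =>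
      simp only [Fin.ext_iff, Fin.val_natAdd, Fin.val_castAdd]
      exact ⟨fun _ a => by omega, fun _ => ⟨i, rfl⟩⟩
    | right a =>
      simp only [Fin.ext_iff, Fin.val_natAdd, Fin.val_castAdd]
      exact ⟨fun ⟨i, hi⟩ => by omega, fun h => absurd rfl (h a)⟩

theorem position_descendantWord (a : Fin (∑ i, r i)) :
    position (descendantWord r) (Fin.natAdd n a) =
      X (Fin.natAdd n a) + X (Fin.castAdd _ (finSigmaFinEquiv.symm a).1) := by
  rw [position, descendantWord, List.map_ofFn, List.sum_ofFn]
  congr 1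
  refine (Finset.sum_eq_single_of_mem (finSigmaFinEquiv.symm a).1 (Finset.mem_univ _)
    fun i _ hi => ?_).trans ?_
  · simp only [Function.comp_apply, shift]
    rw [if_neg]
    intro hmem
    obtain ⟨j, hj⟩ := List.mem_ofFn.1 hmem
    apply hi
    rw [← Fin.natAdd_injective _ _ hj, Equiv.symm_apply_apply]
  · simp only [Function.comp_apply, shift]
    rw [if_pos]
    exact List.mem_ofFn.2 ⟨(finSigmaFinEquiv.symm a).2, by simp [pointVar]⟩

/-- For a centre w_i, all the x exponents and those of the later centres are fixed, so the inserted
vector and the vector it acts on are fixed and truncation applies. For x_{ij}, truncation inside its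
cluster makes the inserted vector 0 whatever the centres are. -/
theorem isIteratedLaurent_descendantWord (h : A.IsCFTType) :
    IsIteratedLaurent fun e => vacDual h (A.insertionProd (descendantWord r) e A.vac) := by
  have hprod : ∀ e, A.insertionProd (descendantWord r) e =
      (List.ofFn fun i => A.insertionOp e
        (cluster (Fin.castAdd _ i) (List.ofFn (pointVar r i)))).prod := by
    intro e
    rw [insertionProd, descendantWord, List.map_ofFn]; rfl
  have homega : ∀ e i, A.omegaProd (List.ofFn (pointVar r i)) e =
      (List.ofFn fun j => (A.mode A.omega (e (pointVar r i j)) : Module.End ℂ V)).prod := by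
    intro e i
    rw [omegaProd, List.map_ofFn]; rfl
  intro x e
  induction x using Fin.addCases with
  | left i =>
    obtain ⟨B, hB⟩ := A.exists_mode_eq_zero (A.omegaProd (List.ofFn (pointVar r i)) e A.vac)
      (((List.ofFn fun i => A.insertionOp e
        (cluster (Fin.castAdd _ i) (List.ofFn (pointVar r i)))).drop (i + 1)).prod A.vac)
    refine ⟨B, fun e' he' hlt => ?_⟩
    have hcl : ∀ i', A.omegaProd (List.ofFn (pointVar r i')) e' =
        A.omegaProd (List.ofFn (pointVar r i')) e := by
      intro i'
      refine A.omegaProd_congr fun a ha => he' a ?_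
      obtain ⟨j, rfl⟩ := List.mem_ofFn.1 ha
      rw [Fin.lt_def]
      simp [pointVar]; omega
    simp only
    rw [hprod, List.prod_ofFn_apply _ i, List.drop_ofFn_congr i fun j hj => ?_]
    · simp only [insertionOp] at hB ⊢
      rw [hcl, hB _ hlt, map_zero, map_zero]
    · simp only [insertionOp]
      rw [hcl, he' _ (by rw [Fin.lt_def]; simpa using hj)]
  | right a =>
    obtain ⟨⟨i, j⟩, rfl⟩ := finSigmaFinEquiv.surjective a
    obtain ⟨B, hB⟩ := A.exists_mode_eq_zero A.omega
      (((List.ofFn fun j => (A.mode A.omega (e (pointVar r i j)) : Module.End ℂ V)).drop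
        (j + 1)).prod A.vac)
    refine ⟨B, fun e' he' hlt => ?_⟩
    have hzero : A.omegaProd (List.ofFn (pointVar r i)) e' A.vac = 0 := by
      have hagree : ∀ j', j < j' → (A.mode A.omega (e' (pointVar r i j')) : Module.End ℂ V) =
          A.mode A.omega (e (pointVar r i j')) := by
        intro j' hj'
        rw [he' _ ?_]
        rw [Fin.lt_def] at hj' ⊢
        simp only [pointVar, Fin.val_natAdd, finSigmaFinEquiv_apply]
        omega
      rw [homega, List.prod_ofFn_apply _ j, List.drop_ofFn_congr j hagree]
      exact (congrArg _ (hB _ hlt)).trans (map_zero _)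
    simp only
    rw [hprod, List.prod_ofFn_apply _ i]
    simp only [insertionOp, hzero]
    have : ∀ k, A.mode 0 k = 0 := by
      intro k
      simp [mode]
    rw [this, LinearMap.zero_apply, map_zero, map_zero]

theorem shiftedExpand_omegaCorrelator (h : A.IsCFTType) :
    coefficient ((omegaCorrelator h (∑ i, r i)).shiftedExpand r) =
      fun e => vacDual h (A.insertionProd (descendantWord r) e A.vac) := by
  have := eq_coefficient_eval h (isIteratedLaurent_descendantWord r h)
    (fun a => position (descendantWord r) (Fin.natAdd n a)) ?_
    (act_insertionProd h (Fin.natAdd_injective _ _) (act_disc_omegaProd h _) _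
      (isComplete_descendantWord r) rfl)
  · rw [this]
    simp only [position_descendantWord, map_add, aeval_X]
    rfl
  · intro a b hab
    simp only [position_descendantWord] at hab
    -- Positions are distinct, so `disc` does not vanish at them: only the position of the point a
    -- involves its own variable x.
    have hc := congrArg (coeff (Finsupp.single (Fin.natAdd n a) 1)) hab
    simp only [coeff_add, coeff_X, Finsupp.single_left_inj one_ne_zero, Fin.ext_iff,
      Fin.val_natAdd, Fin.val_castAdd] at hc
    by_contra hne
    have hne' : (b : ℕ) ≠ a := fun h => hne (Fin.ext h.symm)
    have h₁ : ((finSigmaFinEquiv.symm a).1 : ℕ) ≠ n + a := by omega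
    have h₂ : ((finSigmaFinEquiv.symm b).1 : ℕ) ≠ n + a := by omega
    rw [if_pos trivial, if_neg h₁, if_neg (by omega), if_neg h₂] at hc
    simp at hc

/-- The exponent l - 2 arises because L_{-l} is the coefficient of z^(l-2) in Y(ω, z). -/
theorem npt_descendant (h : A.IsCFTType) (l : (i : Fin n) → Fin (r i) → ℤ) (k : Fin n → ℤ) :
    npt h (fun i => A.descendant (l i)) k =
      vacDual h (A.insertionProd (descendantWord r) (Fin.append k fun a =>
        l (finSigmaFinEquiv.symm a).1 (finSigmaFinEquiv.symm a).2 - 2) A.vac) := by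
  have hd : ∀ i, A.descendant (l i) = A.omegaProd (List.ofFn (pointVar r i)) (Fin.append k fun a =>
      l (finSigmaFinEquiv.symm a).1 (finSigmaFinEquiv.symm a).2 - 2) A.vac := by
    intro i
    rw [descendant, omegaProd, List.map_ofFn]
    congr 3
    funext j
    rw [Function.comp_apply, pointVar, Fin.append_right, Equiv.symm_apply_apply, L_eq_mode, neg_neg]
  rw [npt, insertionProd, descendantWord, List.map_ofFn]
  simp only [hd]
  congr 4
  funext i
  simp only [Function.comp_apply, insertionOp, Fin.append_left]
  rfl

end Descendants

end VOA

theorem mainTheorem9 {V : Type*} [AddCommGroup V] [Module ℂ V] (A : VOA V) (h : A.IsCFTType) :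
    ∃ G : (m : ℕ) → MvRat m,
      -- `G m` is the unique rational function whose expansion is the Virasoro `m`-point function
      (∀ (m : ℕ) (f : MvRat m),
        (∀ k : Fin m → ℤ, f.expand.coefficient k = VOA.npt h (fun _ => A.omega) k) ↔ f = G m) ∧
      (∀ m : ℕ, (G m).IsSymmetric) ∧
      -- the `n`-point function of the descendants `L_{-l_{i1}} ⋯ L_{-l_{i r_i}} 𝟏` is the
      -- coefficient of the product of the `x_{ij} ^ (l_{ij} - 2)`
      (∀ (n : ℕ) (r : Fin n → ℕ) (l : (i : Fin n) → Fin (r i) → ℤ) (k : Fin n → ℤ),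
        VOA.npt h (fun i => A.descendant (l i)) k =
          ((G (∑ i, r i)).shiftedExpand r).coefficient
            (Fin.append k fun a =>
              l (finSigmaFinEquiv.symm a).1 (finSigmaFinEquiv.symm a).2 - 2)) := by
  refine ⟨VOA.omegaCorrelator h, fun m f => ⟨fun hf => ?_, ?_⟩,
    VOA.omegaCorrelator_isSymmetric h, fun n r l k => ?_⟩
  · apply MvRat.expand_injective
    apply ExpansionField.coefficient_injective
    rw [VOA.expand_omegaCorrelator]
    exact funext hf
  · rintro rfl k
    rw [VOA.expand_omegaCorrelator]
  · rw [VOA.shiftedExpand_omegaCorrelator, VOA.npt_descendant]
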